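/- **Conventions.** A compact quantum group (CQG) is a pair $(Q,\Delta)$ of a (nonzero) unital $C^*$-algebra $Q$ and a coassociative unital $*$-homomorphism $\Delta:Q\to Q\otimes Q$ (minimal tensor product) such that the linear spans of $(Q\otimes 1)\Delta(Q)$ and of $(1\otimes Q)\Delta(Q)$ are dense in $Q\otimes Q$. A unitary corepresentation of $Q$ on a Hilbert space $\mathcal H$ is a unitary $U\in\mathcal M(\mathcal K(\mathcal H)\otimes Q)$ with $(\mathrm{id}\otimes\Delta)U=U_{(12)}U_{(13)}$. A unital real spectral triple $(\mathcal A,\mathcal H,D,\gamma,J)$ consists of a complex Hilbert space $\mathcal H$, a complex unital $*$-algebra $\mathcal A$ faithfully and unitally represented on $\mathcal H$, a self-adjoint operator $D$ with compact resolvent and with bounded commutators $[D,a]$, $a\in\mathcal A$, an operator $\gamma$ that is either a $\mathbb Z_2$-grading commuting with $\mathcal A$ and anticommuting with $D$ (even case) or $\gamma=1$ (odd case), and an antilinear isometry $J$ with $J^2=\epsilon 1$, $JD=\epsilon' DJ$, $J\gamma=\epsilon''\gamma J$ for signs $\epsilon,\epsilon',\epsilon''$, and $[a,JbJ^{-1}]=0=[[D,a],JbJ^{-1}]$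 for all $a,b\in\mathcal A$. Given data $(\mathcal A,\mathcal H,D,\gamma,J)$, a CQG $Q$ *coacts by orientation and real structure preserving isometries* through a unitary corepresentation $U$ on $\mathcal H$ if 1. $U$ commutes with $D\otimes 1$ and with $\gamma\otimes 1$; 2. $(J\otimes *)U(\xi\otimes 1_Q)=U(J\xi\otimes 1_Q)$ for all $\xi\in\mathcal H$; 3. $(\mathrm{id}\otimes\varphi)\bigl(U(a\otimes 1_Q)U^*\bigr)\in\mathcal A''$ for all $a\in\mathcal A$ and every state $\varphi$ of $Q$. $\widetilde{\mathrm{QISO}}^+(\mathcal A,\mathcal H,D,\gamma,J)$ denotes a universal such pair $(Q,U)$: for every other such pair $(Q',U')$ there is a unique CQG morphism $\varphi:Q\to Q'$ with $(\mathrm{id}\otimes\varphi)(U)=U'$. **Lemma.** Let $(\mathcal A_1,\mathcal H_1,D_1,\gamma_1,J_1)$ be any unital real spectral triple and $(\mathcal A_2,\mathcal H_2,D_2,\gamma_2,J_2)$ a unital even real spectral triple with $\mathcal H_2$ finite-dimensional. Let $(\mathcal A,\mathcal H,D,\gamma,J)$ be the product $$\mathcal A=\mathcal A_1\otimes_{\mathrm{alg}}\mathcal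 A_2,\quad \mathcal H=\mathcal H_1\otimes\mathcal H_2,\quad D=D_1\otimes\gamma_2+1\otimes D_2,\quad \gamma=\gamma_1\otimes\gamma_2,\quad J=J_1\otimes J_2 .$$ If $(Q,U)$ is $\widetilde{\mathrm{QISO}}^+(\mathcal A_2,\mathcal H_2,D_2,\gamma_2,J_2)$, then $Q$ coacts by orientation and real structure preserving isometries on $(\mathcal A,\mathcal H,D,\gamma,J)$ through the unitary corepresentation $\hat U=1\otimes U$ on $\mathcal H_1\otimes\mathcal H_2$. More generally, the same holds for every pair $(Q,U)$ that coacts by orientation and real structure preserving isometries on $(\mathcal A_2,\mathcal H_2,D_2,\gamma_2,J_2)$, universal or not. -/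

import Mathlib

open scoped TensorProduct InnerProductSpace ComplexConjugate

universe u₁ u₂ v

set_option linter.unusedSectionVars false

noncomputable section

/-! ## Hilbert space tensor products -/

/-- The Hilbert space tensor product: completion of the algebraic tensor product for the inner
product with `⟪x ⊗ y, x' ⊗ y'⟫ = ⟪x, x'⟫ ⟪y, y'⟫`. -/
def HilbertTensor (H K : Type*) [NormedAddCommGroup H] [InnerProductSpace ℂ H]
    [NormedAddCommGroup K] [InnerProductSpace ℂ K] : Type _ :=
  UniformSpace.Completion (H ⊗[ℂ] K)

infixr:100 " ⊗̂ " => HilbertTensor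

namespace HilbertTensor

variable {H H' K K' L : Type*}
  [NormedAddCommGroup H] [InnerProductSpace ℂ H]
  [NormedAddCommGroup H'] [InnerProductSpace ℂ H']
  [NormedAddCommGroup K] [InnerProductSpace ℂ K]
  [NormedAddCommGroup K'] [InnerProductSpace ℂ K']
  [NormedAddCommGroup L] [InnerProductSpace ℂ L]

instance instNormedAddCommGroup : NormedAddCommGroup (H ⊗̂ K) :=
  inferInstanceAs (NormedAddCommGroup (UniformSpace.Completion (H ⊗[ℂ] K)))

instance instInnerProductSpace : InnerProductSpace ℂ (H ⊗̂ K) :=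
  inferInstanceAs (InnerProductSpace ℂ (UniformSpace.Completion (H ⊗[ℂ] K)))

instance instCompleteSpace : CompleteSpace (H ⊗̂ K) :=
  inferInstanceAs (CompleteSpace (UniformSpace.Completion (H ⊗[ℂ] K)))

/-- The inclusion of the algebraic tensor product. -/
def incl (H K : Type*) [NormedAddCommGroup H] [InnerProductSpace ℂ H]
    [NormedAddCommGroup K] [InnerProductSpace ℂ K] : H ⊗[ℂ] K →ₗᵢ[ℂ] H ⊗̂ K :=
  (UniformSpace.Completion.toComplₗᵢ : H ⊗[ℂ] K →ₗᵢ[ℂ] UniformSpace.Completion (H ⊗[ℂ] K))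

/-- The simple tensor `ξ ⊗ k` in the Hilbert space tensor product. -/
def tmul (ξ : H) (k : K) : H ⊗̂ K := incl H K (ξ ⊗ₜ[ℂ] k)

theorem denseRange_incl : DenseRange (incl H K) :=
  UniformSpace.Completion.denseRange_coe

theorem isUniformInducing_incl :
    IsUniformInducing (incl H K).toContinuousLinearMap :=
  (incl H K).isometry.isUniformInducing

/-- The bounded operator `S ⊗ T` on Hilbert space tensor products. -/
def mapL (S : H →L[ℂ] H') (T : K →L[ℂ] K') : H ⊗̂ K →L[ℂ] H' ⊗̂ K' :=
  ((incl H' K').toContinuousLinearMap ∘L TensorProduct.mapL S T).extend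
    (incl H K).toContinuousLinearMap

theorem mapL_incl (S : H →L[ℂ] H') (T : K →L[ℂ] K') (x : H ⊗[ℂ] K) :
    mapL S T (incl H K x) = incl H' K' (TensorProduct.map S.toLinearMap T.toLinearMap x) := by
  have h := ContinuousLinearMap.extend_eq
    ((incl H' K').toContinuousLinearMap ∘L TensorProduct.mapL S T)
    (e := (incl H K).toContinuousLinearMap) denseRange_incl isUniformInducing_incl x
  refine Eq.trans h ?_
  rw [ContinuousLinearMap.comp_apply, TensorProduct.mapL_apply]
  rfl

theorem mapL_tmul (S : H →L[ℂ] H') (T : K →L[ℂ] K') (ξ : H) (k : K) :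
    mapL S T (tmul ξ k) = tmul (S ξ) (T k) :=
  mapL_incl S T _

/-- The flip `H ⊗ K ≅ K ⊗ H`. -/
def flip (H K : Type*) [NormedAddCommGroup H] [InnerProductSpace ℂ H]
    [NormedAddCommGroup K] [InnerProductSpace ℂ K] : H ⊗̂ K ≃ₗᵢ[ℂ] K ⊗̂ H :=
  (TensorProduct.comm ℂ H K).extendOfIsometry (incl H K).toLinearMap (incl K H).toLinearMap
    denseRange_incl denseRange_incl
    (fun x => by
      change ‖incl K H _‖ = ‖incl H K x‖
      rw [LinearIsometry.norm_map, LinearIsometry.norm_map, TensorProduct.norm_comm])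

theorem flip_tmul (ξ : H) (k : K) : flip H K (tmul ξ k) = tmul k ξ :=
  LinearEquiv.extendOfIsometry_eq _ _ _ _ _ _ (ξ ⊗ₜ[ℂ] k)

/-- The inclusion of `(H ⊗ K) ⊗ L` (algebraic) into its iterated completion. -/
def inclLeft (H K L : Type*) [NormedAddCommGroup H] [InnerProductSpace ℂ H]
    [NormedAddCommGroup K] [InnerProductSpace ℂ K] [NormedAddCommGroup L]
    [InnerProductSpace ℂ L] : (H ⊗[ℂ] K) ⊗[ℂ] L →ₗᵢ[ℂ] (H ⊗̂ K) ⊗̂ L :=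
  (incl (H ⊗̂ K) L).comp (TensorProduct.mapIsometry (incl H K) LinearIsometry.id)

/-- The inclusion of `H ⊗ (K ⊗ L)` (algebraic) into its iterated completion. -/
def inclRight (H K L : Type*) [NormedAddCommGroup H] [InnerProductSpace ℂ H]
    [NormedAddCommGroup K] [InnerProductSpace ℂ K] [NormedAddCommGroup L]
    [InnerProductSpace ℂ L] : H ⊗[ℂ] (K ⊗[ℂ] L) →ₗᵢ[ℂ] H ⊗̂ (K ⊗̂ L) :=
  (incl H (K ⊗̂ L)).comp (TensorProduct.mapIsometry LinearIsometry.id (incl K L))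

theorem denseRange_map_left :
    DenseRange (TensorProduct.mapIsometry (incl H K) (LinearIsometry.id : L →ₗᵢ[ℂ] L)) := by
  let f := TensorProduct.mapIsometry (incl H K) (LinearIsometry.id : L →ₗᵢ[ℂ] L)
  let S : Submodule ℂ ((H ⊗̂ K) ⊗[ℂ] L) := (LinearMap.range f.toLinearMap).topologicalClosure
  have key : ∀ x : (H ⊗̂ K) ⊗[ℂ] L, x ∈ S := by
    intro x
    induction x using TensorProduct.induction_on with
    | zero => exact S.zero_mem
    | add a b ha hb => exact S.add_mem ha hb
    | tmul a l =>
      induction a using (denseRange_incl (H := H) (K := K)).induction_on with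
      | hp =>
        have hc : Continuous fun a : H ⊗̂ K => a ⊗ₜ[ℂ] l :=
          TensorProduct.continuous_tmul.comp (Continuous.prodMk_left l)
        exact (Submodule.isClosed_topologicalClosure _).preimage hc
      | ih a => exact Submodule.le_topologicalClosure _ ⟨a ⊗ₜ[ℂ] l, rfl⟩
  exact fun x => key x

theorem denseRange_map_right :
    DenseRange (TensorProduct.mapIsometry (LinearIsometry.id : H →ₗᵢ[ℂ] H) (incl K L)) := by
  let f := TensorProduct.mapIsometry (LinearIsometry.id : H →ₗᵢ[ℂ] H) (incl K L)
  let S : Submodule ℂ (H ⊗[ℂ] (K ⊗̂ L)) := (LinearMap.range f.toLinearMap).topologicalClosure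
  have key : ∀ x : H ⊗[ℂ] (K ⊗̂ L), x ∈ S := by
    intro x
    induction x using TensorProduct.induction_on with
    | zero => exact S.zero_mem
    | add a b ha hb => exact S.add_mem ha hb
    | tmul ξ a =>
      induction a using (denseRange_incl (H := K) (K := L)).induction_on with
      | hp =>
        have hc : Continuous fun a : K ⊗̂ L => ξ ⊗ₜ[ℂ] a :=
          TensorProduct.continuous_tmul.comp (Continuous.prodMk_right ξ)
        exact (Submodule.isClosed_topologicalClosure _).preimage hc
      | ih a => exact Submodule.le_topologicalClosure _ ⟨ξ ⊗ₜ[ℂ] a, rfl⟩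
  exact fun x => key x

theorem denseRange_inclLeft : DenseRange (inclLeft H K L) :=
  denseRange_incl.comp denseRange_map_left (incl (H ⊗̂ K) L).continuous

theorem denseRange_inclRight : DenseRange (inclRight H K L) :=
  denseRange_incl.comp denseRange_map_right (incl H (K ⊗̂ L)).continuous

/-- The associator `(H ⊗ K) ⊗ L ≅ H ⊗ (K ⊗ L)`. -/
def assoc (H K L : Type*) [NormedAddCommGroup H] [InnerProductSpace ℂ H]
    [NormedAddCommGroup K] [InnerProductSpace ℂ K] [NormedAddCommGroup L]
    [InnerProductSpace ℂ L] : (H ⊗̂ K) ⊗̂ L ≃ₗᵢ[ℂ] H ⊗̂ (K ⊗̂ L) :=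
  (TensorProduct.assoc ℂ H K L).extendOfIsometry
    (inclLeft H K L).toLinearMap (inclRight H K L).toLinearMap
    denseRange_inclLeft denseRange_inclRight
    (fun x => by
      change ‖inclRight H K L _‖ = ‖inclLeft H K L x‖
      rw [LinearIsometry.norm_map, LinearIsometry.norm_map, TensorProduct.norm_assoc])

theorem assoc_tmul (ξ : H) (k : K) (l : L) :
    assoc H K L (tmul (tmul ξ k) l) = tmul ξ (tmul k l) :=
  LinearEquiv.extendOfIsometry_eq _ _ _ _ _ _ ((ξ ⊗ₜ[ℂ] k) ⊗ₜ[ℂ] l)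

/-- An operator on `(H ⊗ K) ⊗ L` transported to `H ⊗ (K ⊗ L)`. -/
def assocConj (T : (H ⊗̂ K) ⊗̂ L →L[ℂ] (H ⊗̂ K) ⊗̂ L) :
    H ⊗̂ (K ⊗̂ L) →L[ℂ] H ⊗̂ (K ⊗̂ L) :=
  ((assoc H K L).toContinuousLinearEquiv : _ →L[ℂ] _) ∘L T ∘L
    ((assoc H K L).symm.toContinuousLinearEquiv : _ →L[ℂ] _)

/-- The ampliation `1 ⊗ T` on `(H ⊗ K) ⊗ L` of an operator `T` on `K ⊗ L`. -/
def ampl (H : Type*) [NormedAddCommGroup H] [InnerProductSpace ℂ H]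
    (T : K ⊗̂ L →L[ℂ] K ⊗̂ L) : (H ⊗̂ K) ⊗̂ L →L[ℂ] (H ⊗̂ K) ⊗̂ L :=
  ((assoc H K L).symm.toContinuousLinearEquiv : _ →L[ℂ] _) ∘L
    mapL (ContinuousLinearMap.id ℂ H) T ∘L
      ((assoc H K L).toContinuousLinearEquiv : _ →L[ℂ] _)

/-- Leg numbering: `T₁₂ = T ⊗ 1` on `H ⊗ (K ⊗ K)`. -/
def leg12 (T : H ⊗̂ K →L[ℂ] H ⊗̂ K) : H ⊗̂ (K ⊗̂ K) →L[ℂ] H ⊗̂ (K ⊗̂ K) :=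
  assocConj (mapL T (ContinuousLinearMap.id ℂ K))

/-- Leg numbering: `T₁₃ = (1 ⊗ σ) T₁₂ (1 ⊗ σ)` on `H ⊗ (K ⊗ K)`, with `σ` the flip. -/
def leg13 (T : H ⊗̂ K →L[ℂ] H ⊗̂ K) : H ⊗̂ (K ⊗̂ K) →L[ℂ] H ⊗̂ (K ⊗̂ K) :=
  let F : H ⊗̂ (K ⊗̂ K) →L[ℂ] H ⊗̂ (K ⊗̂ K) :=
    mapL (ContinuousLinearMap.id ℂ H) ((flip K K).toContinuousLinearEquiv : _ →L[ℂ] _)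
  F ∘L leg12 T ∘L F

/-- The operator `K → H ⊗ K`, `k ↦ ξ ⊗ k`; as an element of the Hilbert module `H ⊗ Q`
(for `Q ⊆ B(K)` unital) this is the vector `ξ ⊗ 1`. -/
def ket (K : Type*) [NormedAddCommGroup K] [InnerProductSpace ℂ K] (ξ : H) :
    K →L[ℂ] H ⊗̂ K :=
  (incl H K).toContinuousLinearMap ∘L TensorProduct.mkL ℂ H K ξ

theorem ket_apply (ξ : H) (k : K) : ket K ξ k = tmul ξ k := rfl

theorem inner_antilinear (J : H →ₗᵢ⋆[ℂ] H) (x y : H) :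
    ⟪J x, J y⟫_ℂ = conj ⟪x, y⟫_ℂ := by
  have hI : ∀ z : H, (Complex.I : ℂ) • J z = - J (Complex.I • z) := by
    intro z; rw [LinearIsometry.map_smulₛₗ]; simp
  have h1 : ‖J x + J y‖ = ‖x + y‖ := by rw [← map_add, LinearIsometry.norm_map]
  have h2 : ‖J x - J y‖ = ‖x - y‖ := by rw [← map_sub, LinearIsometry.norm_map]
  have h3 : ‖J x - (Complex.I : ℂ) • J y‖ = ‖x + (Complex.I : ℂ) • y‖ := by
    rw [hI, sub_neg_eq_add, ← map_add, LinearIsometry.norm_map]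
  have h4 : ‖J x + (Complex.I : ℂ) • J y‖ = ‖x - (Complex.I : ℂ) • y‖ := by
    rw [hI, ← sub_eq_add_neg, ← map_sub, LinearIsometry.norm_map]
  have h5 : (starRingEnd ℂ) 4 = 4 := Complex.conj_ofNat 4
  rw [inner_eq_sum_norm_sq_div_four (𝕜 := ℂ) (J x) (J y),
    inner_eq_sum_norm_sq_div_four (𝕜 := ℂ) x y]
  simp only [RCLike.I_to_complex, h1, h2, h3, h4]
  simp only [map_div₀, map_add, map_sub, map_mul, map_pow, Complex.conj_I, Complex.conj_ofReal,
    RCLike.ofReal_eq_complex_ofReal, h5]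
  ring

theorem inner_map_antilinear (J₁ : H →ₗᵢ⋆[ℂ] H) (J₂ : K →ₗᵢ⋆[ℂ] K) (x y : H ⊗[ℂ] K) :
    ⟪TensorProduct.map J₁.toLinearMap J₂.toLinearMap x,
      TensorProduct.map J₁.toLinearMap J₂.toLinearMap y⟫_ℂ = conj ⟪x, y⟫_ℂ := by
  induction x using TensorProduct.induction_on with
  | zero => simp
  | add a b ha hb => simp only [map_add, inner_add_left, ha, hb]
  | tmul ξ k =>
    induction y using TensorProduct.induction_on with
    | zero => simp
    | add a b ha hb => simp only [map_add, inner_add_right, ha, hb]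
    | tmul ξ' k' =>
      simp only [TensorProduct.map_tmul, TensorProduct.inner_tmul, map_mul]
      congr 1
      · exact inner_antilinear J₁ ξ ξ'
      · exact inner_antilinear J₂ k k'

theorem norm_map_antilinear (J₁ : H →ₗᵢ⋆[ℂ] H) (J₂ : K →ₗᵢ⋆[ℂ] K) (x : H ⊗[ℂ] K) :
    ‖TensorProduct.map J₁.toLinearMap J₂.toLinearMap x‖ = ‖x‖ := by
  have h := congrArg (fun z : ℂ => √(RCLike.re z)) (inner_map_antilinear J₁ J₂ x x)
  simp only [RCLike.conj_re] at h
  have e : ∀ y : H ⊗[ℂ] K, √(RCLike.re (inner ℂ y y)) = ‖y‖ := fun y =>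
    (norm_eq_sqrt_re_inner (𝕜 := ℂ) y).symm
  rwa [e, e] at h

/-- The antilinear isometry `J₁ ⊗ J₂` on the algebraic tensor product. -/
def antilinearAlg (J₁ : H →ₗᵢ⋆[ℂ] H) (J₂ : K →ₗᵢ⋆[ℂ] K) : H ⊗[ℂ] K →ₗᵢ⋆[ℂ] H ⊗[ℂ] K where
  toLinearMap := TensorProduct.map J₁.toLinearMap J₂.toLinearMap
  norm_map' := norm_map_antilinear J₁ J₂

/-- The antilinear isometry `J₁ ⊗ J₂` from the algebraic to the Hilbert space tensor product. -/
def antilinearIncl (J₁ : H →ₗᵢ⋆[ℂ] H) (J₂ : K →ₗᵢ⋆[ℂ] K) : H ⊗[ℂ] K →L⋆[ℂ] H ⊗̂ K :=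
  ((incl H K).comp (antilinearAlg J₁ J₂)).toContinuousLinearMap

/-- The bounded antilinear extension of `J₁ ⊗ J₂` to the Hilbert space tensor product. -/
def antilinearL (J₁ : H →ₗᵢ⋆[ℂ] H) (J₂ : K →ₗᵢ⋆[ℂ] K) : H ⊗̂ K →L⋆[ℂ] H ⊗̂ K :=
  (antilinearIncl J₁ J₂).extend (incl H K).toContinuousLinearMap

theorem antilinearL_incl (J₁ : H →ₗᵢ⋆[ℂ] H) (J₂ : K →ₗᵢ⋆[ℂ] K) (x : H ⊗[ℂ] K) :
    antilinearL J₁ J₂ (incl H K x) = incl H K (antilinearAlg J₁ J₂ x) := by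
  have h := ContinuousLinearMap.extend_eq (antilinearIncl J₁ J₂)
    (e := (incl H K).toContinuousLinearMap) denseRange_incl isUniformInducing_incl x
  exact h

/-- The antilinear isometry `J₁ ⊗ J₂` on the Hilbert space tensor product. -/
def antilinearMap (J₁ : H →ₗᵢ⋆[ℂ] H) (J₂ : K →ₗᵢ⋆[ℂ] K) : H ⊗̂ K →ₗᵢ⋆[ℂ] H ⊗̂ K where
  toLinearMap := (antilinearL J₁ J₂).toLinearMap
  norm_map' := by
    intro x
    induction x using (denseRange_incl (H := H) (K := K)).induction_on with
    | hp => exact isClosed_eq (antilinearL J₁ J₂).continuous.norm continuous_norm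
    | ih a =>
      change ‖antilinearL J₁ J₂ (incl H K a)‖ = _
      rw [antilinearL_incl, LinearIsometry.norm_map, LinearIsometry.norm_map,
        LinearIsometry.norm_map]

theorem antilinearMap_tmul (J₁ : H →ₗᵢ⋆[ℂ] H) (J₂ : K →ₗᵢ⋆[ℂ] K) (ξ : H) (k : K) :
    antilinearMap J₁ J₂ (tmul ξ k) = tmul (J₁ ξ) (J₂ k) :=
  antilinearL_incl J₁ J₂ (ξ ⊗ₜ[ℂ] k)

/-! ### Unbounded operators on tensor products -/

/-- The inclusion of the algebraic tensor product of two subspaces. -/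
def domIncl (E : Submodule ℂ H) (F : Submodule ℂ K) : E ⊗[ℂ] F →ₗᵢ[ℂ] H ⊗̂ K :=
  (incl H K).comp (TensorProduct.mapInclIsometry E F)

/-- The unbounded operator whose domain is the algebraic tensor product `E ⊗ F` (inside the
Hilbert space tensor product), where it is given by `f`. -/
def pmapOfDomain (E : Submodule ℂ H) (F : Submodule ℂ K) (f : E ⊗[ℂ] F →ₗ[ℂ] H ⊗̂ K) :
    H ⊗̂ K →ₗ.[ℂ] H ⊗̂ K where
  domain := LinearMap.range (domIncl E F).toLinearMap
  toFun := f ∘ₗ (LinearEquiv.ofInjective (domIncl E F).toLinearMap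
    (show Function.Injective (domIncl E F) from (domIncl E F).isometry.injective)).symm.toLinearMap

/-- The operator `D ⊗ 1` on `H ⊗ K`: the closure of the algebraic `D ⊗ 1` on `dom D ⊗ K`. -/
def amplD (D : H →ₗ.[ℂ] H) (K : Type*) [NormedAddCommGroup K] [InnerProductSpace ℂ K] :
    H ⊗̂ K →ₗ.[ℂ] H ⊗̂ K :=
  (pmapOfDomain D.domain (⊤ : Submodule ℂ K)
    ((incl H K).toLinearMap ∘ₗ
      TensorProduct.map D.toFun (⊤ : Submodule ℂ K).subtype)).closure

/-- The operator `D₁ ⊗ γ₂ + 1 ⊗ D₂` on the algebraic tensor product of the domains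
(if the second Hilbert space is finite-dimensional this is already a closed operator). -/
def prodD (D₁ : H →ₗ.[ℂ] H) (γ₂ : K →L[ℂ] K) (D₂ : K →ₗ.[ℂ] K) :
    H ⊗̂ K →ₗ.[ℂ] H ⊗̂ K :=
  pmapOfDomain D₁.domain D₂.domain
    ((incl H K).toLinearMap ∘ₗ
      (TensorProduct.map D₁.toFun (γ₂.toLinearMap ∘ₗ D₂.domain.subtype) +
        TensorProduct.map D₁.domain.subtype D₂.toFun))

/-! ### Slices and spatial tensor products of operator spaces -/

section Complete

variable [CompleteSpace H] [CompleteSpace K]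

/-- The slice `(ω_{η,ξ} ⊗ id)(T)`, i.e. the operator on `K` with
`⟪k', slice T η ξ k⟫ = ⟪η ⊗ k', T (ξ ⊗ k)⟫`. In Hilbert module notation it is
`⟨η ⊗ 1, T (ξ ⊗ 1)⟩`. -/
def slice (T : H ⊗̂ K →L[ℂ] H ⊗̂ K) (η ξ : H) : K →L[ℂ] K :=
  ContinuousLinearMap.adjoint (ket K η) ∘L T ∘L ket K ξ

theorem inner_slice (T : H ⊗̂ K →L[ℂ] H ⊗̂ K) (η ξ : H) (k' k : K) :
    ⟪k', slice T η ξ k⟫_ℂ = ⟪tmul η k', T (tmul ξ k)⟫_ℂ := by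
  simp [slice, ContinuousLinearMap.adjoint_inner_right, ket_apply]

/-- The spatial (minimal) tensor product: the norm closure in `B(H ⊗ K)` of the span of the
`a ⊗ b` with `a ∈ A ⊆ B(H)` and `b ∈ B ⊆ B(K)`. -/
def spatial (A : Set (H →L[ℂ] H)) (B : Set (K →L[ℂ] K)) :
    Submodule ℂ (H ⊗̂ K →L[ℂ] H ⊗̂ K) :=
  (Submodule.span ℂ {T | ∃ a ∈ A, ∃ b ∈ B, T = mapL a b}).topologicalClosure

theorem mapL_mem_spatial {A : Set (H →L[ℂ] H)} {B : Set (K →L[ℂ] K)} {a : H →L[ℂ] H}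
    {b : K →L[ℂ] K} (ha : a ∈ A) (hb : b ∈ B) : mapL a b ∈ spatial A B :=
  Submodule.le_topologicalClosure _ (Submodule.subset_span ⟨a, ha, b, hb, rfl⟩)

theorem slice_mapL (a : H →L[ℂ] H) (b : K →L[ℂ] K) (η ξ : H) :
    slice (mapL a b) η ξ = ⟪η, a ξ⟫_ℂ • b := by
  ext k
  refine ext_inner_left ℂ fun k' => ?_
  rw [inner_slice, mapL_tmul]
  simp [tmul, inner_smul_right]

theorem continuous_slice (η ξ : H) :
    Continuous fun T : H ⊗̂ K →L[ℂ] H ⊗̂ K => slice T η ξ := by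
  unfold slice; fun_prop

theorem slice_mem_of_mem_spatial {A : Set (H →L[ℂ] H)} {B : Submodule ℂ (K →L[ℂ] K)}
    (hB : IsClosed (B : Set (K →L[ℂ] K))) {T : H ⊗̂ K →L[ℂ] H ⊗̂ K}
    (hT : T ∈ spatial A (B : Set (K →L[ℂ] K))) (η ξ : H) : slice T η ξ ∈ B := by
  have hcl : IsClosed {T : H ⊗̂ K →L[ℂ] H ⊗̂ K | slice T η ξ ∈ B} :=
    hB.preimage (continuous_slice η ξ)
  refine closure_minimal (fun S hS => ?_) hcl hT
  change slice S η ξ ∈ B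
  induction hS using Submodule.span_induction with
  | mem S hS =>
    obtain ⟨a, _, b, hb, rfl⟩ := hS
    rw [slice_mapL]; exact B.smul_mem _ hb
  | zero => simp [slice]
  | add S T _ _ hS hT =>
    have : slice (S + T) η ξ = slice S η ξ + slice T η ξ := by
      simp [slice, ContinuousLinearMap.comp_add, ContinuousLinearMap.add_comp]
    rw [this]; exact B.add_mem hS hT
  | smul c S _ hS =>
    have : slice (c • S) η ξ = c • slice S η ξ := by
      simp [slice, ContinuousLinearMap.smul_comp]
    rw [this]; exact B.smul_mem _ hS

/-- The multiplier algebra `M(K(H) ⊗ Q)`, realised in `B(H ⊗ K)` for a unital C*-algebra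
`Q ⊆ B(K)`: the operators `T` with `T (K(H) ⊗ Q) ⊆ K(H) ⊗ Q` and `(K(H) ⊗ Q) T ⊆ K(H) ⊗ Q`,
where `K(H)` are the compact operators. -/
def IsMultiplier (Q : Submodule ℂ (K →L[ℂ] K)) (T : H ⊗̂ K →L[ℂ] H ⊗̂ K) : Prop :=
  ∀ X ∈ spatial {k : H →L[ℂ] H | IsCompactOperator k} (Q : Set (K →L[ℂ] K)),
    T ∘L X ∈ spatial {k : H →L[ℂ] H | IsCompactOperator k} (Q : Set (K →L[ℂ] K)) ∧
    X ∘L T ∈ spatial {k : H →L[ℂ] H | IsCompactOperator k} (Q : Set (K →L[ℂ] K))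

/-- The slices of a multiplier of `K(H) ⊗ Q` lie in `Q`, because `Q` is unital. -/
theorem IsMultiplier.slice_mem {Q : Submodule ℂ (K →L[ℂ] K)} (h1 : 1 ∈ Q)
    (hQ : IsClosed (Q : Set (K →L[ℂ] K))) {T : H ⊗̂ K →L[ℂ] H ⊗̂ K} (hT : IsMultiplier Q T)
    (η ξ : H) : slice T η ξ ∈ Q := by
  let P : H →L[ℂ] H := (innerSL ℂ ξ).smulRight ξ
  have hP : IsCompactOperator P := by
    have h : IsCompactOperator (ContinuousLinearMap.id ℂ ℂ) :=
      isCompactOperator_id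
    have h2 := h.clm_comp (ContinuousLinearMap.toSpanSingleton ℂ ξ)
    exact h2.comp_clm (innerSL ℂ ξ)
  have hmem := slice_mem_of_mem_spatial hQ
    (hT _ (mapL_mem_spatial (a := P) (b := (1 : K →L[ℂ] K)) hP h1)).1 η ξ
  have hPξ : P ξ = ⟪ξ, ξ⟫_ℂ • ξ := rfl
  have hs : slice (T ∘L mapL P 1) η ξ = ⟪ξ, ξ⟫_ℂ • slice T η ξ := by
    ext k
    refine ext_inner_left ℂ fun k' => ?_
    have ht : tmul (⟪ξ, ξ⟫_ℂ • ξ) k = ⟪ξ, ξ⟫_ℂ • tmul ξ k := by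
      simp only [tmul]
      rw [← TensorProduct.smul_tmul', map_smul]
    have h1k : (1 : K →L[ℂ] K) k = k := rfl
    rw [inner_slice, ContinuousLinearMap.comp_apply, mapL_tmul, hPξ, h1k, ht, map_smul,
      inner_smul_right, smul_apply, inner_smul_right, inner_slice]
  rw [hs] at hmem
  by_cases h0 : ξ = 0
  · subst h0
    have : slice T η 0 = 0 := by
      ext k
      simp [slice, ket]
    rw [this]; exact Q.zero_mem
  · have hne : ⟪ξ, ξ⟫_ℂ ≠ 0 := inner_self_ne_zero.2 h0
    have := Q.smul_mem (⟪ξ, ξ⟫_ℂ)⁻¹ hmem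
    rwa [smul_smul, inv_mul_cancel₀ hne, one_smul] at this

end Complete

end HilbertTensor

open HilbertTensor

/-- `Φ` is the tensor product `f ⊗ g` on the spatial tensor product `A ⊗ B`: the (unique) bounded
extension of `a ⊗ b ↦ f a ⊗ g b`. -/
def IsTensorMap {H K H' K' : Type*}
    [NormedAddCommGroup H] [InnerProductSpace ℂ H] [CompleteSpace H]
    [NormedAddCommGroup K] [InnerProductSpace ℂ K] [CompleteSpace K]
    [NormedAddCommGroup H'] [InnerProductSpace ℂ H'] [CompleteSpace H']
    [NormedAddCommGroup K'] [InnerProductSpace ℂ K'] [CompleteSpace K']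
    {A : StarSubalgebra ℂ (H →L[ℂ] H)} {B : StarSubalgebra ℂ (K →L[ℂ] K)}
    (f : A →ₗ[ℂ] (H' →L[ℂ] H')) (g : B →ₗ[ℂ] (K' →L[ℂ] K'))
    (Φ : spatial (A : Set (H →L[ℂ] H)) (B : Set (K →L[ℂ] K)) →L[ℂ]
      (H' ⊗̂ K' →L[ℂ] H' ⊗̂ K')) : Prop :=
  ∀ (a : A) (b : B), Φ ⟨mapL a.1 b.1, mapL_mem_spatial a.2 b.2⟩ = mapL (f a) (g b)

/-! ## Compact quantum groups -/

/-- A compact quantum group: a unital C*-algebra `alg`, faithfully represented on a Hilbert space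
`space`, with a coassociative unital *-homomorphism `comul` into the minimal tensor product
`alg ⊗ alg ⊆ B(space ⊗ space)` satisfying the density (cancellation) conditions. -/
structure CompactQuantumGroup where
  space : Type v
  [instNACG : NormedAddCommGroup space]
  [instIPS : InnerProductSpace ℂ space]
  [instComplete : CompleteSpace space]
  [instNontrivial : Nontrivial space]
  alg : StarSubalgebra ℂ (space →L[ℂ] space)
  isClosed_alg : IsClosed (alg : Set (space →L[ℂ] space))
  comul : alg →⋆ₐ[ℂ] (space ⊗̂ space →L[ℂ] space ⊗̂ space)
  comul_mem : ∀ a, comul a ∈ spatial (alg : Set (space →L[ℂ] space)) alg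
  /-- `(Δ ⊗ id) Δ = (id ⊗ Δ) Δ`, up to the identification of `(K ⊗ K) ⊗ K` with `K ⊗ (K ⊗ K)`. -/
  coassoc : ∃ (Φ : spatial (alg : Set (space →L[ℂ] space)) (alg : Set (space →L[ℂ] space)) →L[ℂ]
        ((space ⊗̂ space) ⊗̂ space →L[ℂ] (space ⊗̂ space) ⊗̂ space))
      (Ψ : spatial (alg : Set (space →L[ℂ] space)) (alg : Set (space →L[ℂ] space)) →L[ℂ]
        (space ⊗̂ (space ⊗̂ space) →L[ℂ] space ⊗̂ (space ⊗̂ space))),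
    IsTensorMap comul.toAlgHom.toLinearMap alg.subtype.toAlgHom.toLinearMap Φ ∧
    IsTensorMap alg.subtype.toAlgHom.toLinearMap comul.toAlgHom.toLinearMap Ψ ∧
    ∀ a, assocConj (Φ ⟨comul a, comul_mem a⟩) = Ψ ⟨comul a, comul_mem a⟩
  dense_left : ∀ T ∈ spatial (alg : Set (space →L[ℂ] space)) alg,
    T ∈ (Submodule.span ℂ {S | ∃ a b : alg, S = mapL a.1 1 ∘L comul b}).topologicalClosure
  dense_right : ∀ T ∈ spatial (alg : Set (space →L[ℂ] space)) alg,
    T ∈ (Submodule.span ℂ {S | ∃ a b : alg, S = mapL 1 a.1 ∘L comul b}).topologicalClosure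

namespace CompactQuantumGroup

attribute [instance] instNACG instIPS instComplete instNontrivial

/-- The underlying closed subspace of `B(space)`. -/
abbrev subspace (Q : CompactQuantumGroup.{v}) : Submodule ℂ (Q.space →L[ℂ] Q.space) :=
  Subalgebra.toSubmodule Q.alg.toSubalgebra

/-- States: positive linear functionals `φ` with `φ 1 = 1`. -/
def IsState (Q : CompactQuantumGroup.{v}) (φ : Q.alg →ₗ[ℂ] ℂ) : Prop :=
  φ 1 = 1 ∧ ∀ a : Q.alg, 0 ≤ (φ (star a * a)).re ∧ (φ (star a * a)).im = 0

/-- A morphism of compact quantum groups `(Q, Δ) → (Q', Δ')`: a unital *-homomorphism `φ` with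
`(φ ⊗ φ) Δ = Δ' φ`. -/
def IsMorphism (Q Q' : CompactQuantumGroup.{v}) (φ : Q.alg →⋆ₐ[ℂ] Q'.alg) : Prop :=
  ∃ Φ, IsTensorMap (Q'.alg.subtype.comp φ).toAlgHom.toLinearMap
      (Q'.alg.subtype.comp φ).toAlgHom.toLinearMap Φ ∧
    ∀ a, Φ ⟨Q.comul a, Q.comul_mem a⟩ = Q'.comul (φ a)

variable {H : Type u₁} [NormedAddCommGroup H] [InnerProductSpace ℂ H] [CompleteSpace H]

/-- The matrix coefficient `⟨η ⊗ 1, T (ξ ⊗ 1)⟩ ∈ Q` of `T ∈ M(K(H) ⊗ Q)`. -/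
def coeff (Q : CompactQuantumGroup.{v}) {T : H ⊗̂ Q.space →L[ℂ] H ⊗̂ Q.space}
    (hT : IsMultiplier Q.subspace T) (η ξ : H) : Q.alg :=
  ⟨slice T η ξ, hT.slice_mem Q.alg.one_mem Q.isClosed_alg η ξ⟩

/-- A unitary corepresentation of `Q` on `H`: a unitary `U ∈ M(K(H) ⊗ Q)` such that
`(id ⊗ Δ) U = U₁₂ U₁₃`. The operator `(id ⊗ Δ) U` is the one whose slices are the
`Δ ((ω ⊗ id) U)`. -/
structure IsUnitaryCorep (Q : CompactQuantumGroup.{v})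
    (U : H ⊗̂ Q.space →L[ℂ] H ⊗̂ Q.space) : Prop where
  isMultiplier : IsMultiplier Q.subspace U
  isUnitary : U ∈ unitary (H ⊗̂ Q.space →L[ℂ] H ⊗̂ Q.space)
  corep : ∀ η ξ : H, Q.comul (Q.coeff isMultiplier η ξ) = slice (leg12 U ∘L leg13 U) η ξ

end CompactQuantumGroup

/-! ## Real spectral triples -/

/-- The data `(A, H, D, γ, J)` underlying a real spectral triple on the Hilbert space `H`; the
*-algebra `A` is identified with its image under its faithful unital representation. -/
structure SpectralData (H : Type u₁) [NormedAddCommGroup H] [InnerProductSpace ℂ H]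
    [CompleteSpace H] where
  alg : StarSubalgebra ℂ (H →L[ℂ] H)
  D : H →ₗ.[ℂ] H
  γ : H →L[ℂ] H
  J : H →ₗᵢ⋆[ℂ] H

namespace SpectralData

section Defs

variable {H : Type u₁} [NormedAddCommGroup H] [InnerProductSpace ℂ H] [CompleteSpace H]
  (T : SpectralData H)

/-- The domain of `D` is invariant under `a`, and `C` is the bounded extension of `[D, a]`. -/
def IsCommutator (a C : H →L[ℂ] H) : Prop :=
  ∀ x : T.D.domain, ∃ h : a x ∈ T.D.domain, T.D ⟨a x, h⟩ - a (T.D x) = C x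

/-- `R` is the resolvent `(D - z)⁻¹`. -/
def IsResolvent (z : ℂ) (R : H →L[ℂ] H) : Prop :=
  (∀ y, ∃ h : R y ∈ T.D.domain, T.D ⟨R y, h⟩ - z • R y = y) ∧
    ∀ x : T.D.domain, R (T.D x - z • (x : H)) = x

/-- `(A, H, D)` is a unital spectral triple. -/
structure IsSpectralTriple : Prop where
  selfAdjoint : IsSelfAdjoint T.D
  compactResolvent : ∃ (z : ℂ) (R : H →L[ℂ] H), T.IsResolvent z R ∧ IsCompactOperator R
  boundedCommutators : ∀ a ∈ T.alg, ∃ C : H →L[ℂ] H, T.IsCommutator a C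

/-- `γ` is a grading making the spectral triple even. -/
structure IsEven : Prop where
  sq : T.γ ∘L T.γ = 1
  selfAdjoint : IsSelfAdjoint T.γ
  commutes : ∀ a ∈ T.alg, T.γ ∘L a = a ∘L T.γ
  anticommutes : ∀ x : T.D.domain, ∃ h : T.γ x ∈ T.D.domain, T.D ⟨T.γ x, h⟩ = - T.γ (T.D x)

/-- `J` is a real structure with signs `ε, ε', ε''`. As `J⁻¹ = ε J`, commuting with `J b J⁻¹` is
the same as commuting with `J b J`. -/
structure IsRealStructure (ε ε' ε'' : ℝ) : Prop where
  sign : ε = 1 ∨ ε = -1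
  sign' : ε' = 1 ∨ ε' = -1
  sign'' : ε'' = 1 ∨ ε'' = -1
  sq : ∀ x, T.J (T.J x) = ε • x
  comm_D : ∀ x : T.D.domain, ∃ h : T.J x ∈ T.D.domain, T.J (T.D x) = ε' • T.D ⟨T.J x, h⟩
  comm_γ : ∀ x, T.J (T.γ x) = ε'' • T.γ (T.J x)
  order_zero : ∀ a ∈ T.alg, ∀ b ∈ T.alg, ∀ x, a (T.J (b (T.J x))) = T.J (b (T.J (a x)))
  order_one : ∀ a ∈ T.alg, ∀ b ∈ T.alg, ∀ C, T.IsCommutator a C →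
    ∀ x, C (T.J (b (T.J x))) = T.J (b (T.J (C x)))

/-- A unital real spectral triple, even with grading `γ`, or odd, with the convention `γ = 1`. -/
structure IsReal : Prop where
  isSpectralTriple : T.IsSpectralTriple
  even_or_odd : T.IsEven ∨ T.γ = 1
  isRealStructure : ∃ ε ε' ε'', T.IsRealStructure ε ε' ε''

/-! ### Quantum isometries -/

/-- The double commutant `A''` in `B(H)`. -/
def doubleCommutant : Set (H →L[ℂ] H) :=
  Set.centralizer (Set.centralizer (T.alg : Set (H →L[ℂ] H)))

variable {K : Type v} [NormedAddCommGroup K] [InnerProductSpace ℂ K] [CompleteSpace K]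

/-- `w' = (J ⊗ *) w` for vectors `w, w'` of the Hilbert module `H ⊗ Q`, considered as operators
`K → H ⊗ K`: the antilinear operator `J ⊗ *` acts on coefficients by
`⟨J η ⊗ 1, (J ⊗ *) w⟩ = ⟨η ⊗ 1, w⟩*`. -/
def IsJStar (J : H →ₗᵢ⋆[ℂ] H) (w w' : K →L[ℂ] H ⊗̂ K) : Prop :=
  ∀ η : H, ContinuousLinearMap.adjoint (ket K (J η)) ∘L w' =
    ContinuousLinearMap.adjoint (ContinuousLinearMap.adjoint (ket K η) ∘L w)

/-- On simple tensors, `(J ⊗ *)(ξ ⊗ q) = J ξ ⊗ q*`. -/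
theorem isJStar_ket (J : H →ₗᵢ⋆[ℂ] H) (ξ : H) (q : K →L[ℂ] K) :
    IsJStar J (ket K ξ ∘L q) (ket K (J ξ) ∘L ContinuousLinearMap.adjoint q) := by
  have key : ∀ a b : H, ContinuousLinearMap.adjoint (ket K a) ∘L ket K b =
      ⟪a, b⟫_ℂ • ContinuousLinearMap.id ℂ K := by
    intro a b
    ext k
    refine ext_inner_left ℂ fun k' => ?_
    simp [ContinuousLinearMap.adjoint_inner_right, ket_apply, tmul, inner_smul_right]
  intro η
  rw [← ContinuousLinearMap.comp_assoc, ← ContinuousLinearMap.comp_assoc, key, key,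
    inner_antilinear]
  ext k
  refine ext_inner_left ℂ fun k' => ?_
  simp [ContinuousLinearMap.adjoint_inner_right, inner_smul_left, inner_smul_right]

/-- If `J` is onto, `(J ⊗ *) w` is unique. -/
theorem IsJStar.unique {J : H →ₗᵢ⋆[ℂ] H} (hJ : Function.Surjective J)
    {w w₁ w₂ : K →L[ℂ] H ⊗̂ K} (h₁ : IsJStar J w w₁) (h₂ : IsJStar J w w₂) : w₁ = w₂ := by
  ext k
  refine (denseRange_incl (H := H) (K := K)).eq_of_inner_left (𝕜 := ℂ) ?_
  intro x
  induction x using TensorProduct.induction_on with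
  | zero => simp
  | add a b ha hb => rw [map_add, inner_add_right, inner_add_right, ha, hb]
  | tmul ξ l =>
    obtain ⟨η, rfl⟩ := hJ ξ
    have h := congrArg (fun S : K →L[ℂ] K => ⟪S k, l⟫_ℂ) ((h₁ η).trans (h₂ η).symm)
    simpa [ContinuousLinearMap.adjoint_inner_left, ket_apply, tmul] using h

/-- `U` commutes with the unbounded operator `S`: `U S = S U`, including equality of domains. -/
def CommutesWith (U : K →L[ℂ] K) (S : K →ₗ.[ℂ] K) : Prop :=
  (∀ x, U x ∈ S.domain ↔ x ∈ S.domain) ∧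
    ∀ (x : S.domain) (h : U x ∈ S.domain), S ⟨U x, h⟩ = U (S x)

/-- `Q` coacts, through the unitary corepresentation `U` on `H`, by orientation and real structure
preserving isometries on `(A, H, D, γ, J)`. -/
structure IsCoaction (Q : CompactQuantumGroup.{v})
    (U : H ⊗̂ Q.space →L[ℂ] H ⊗̂ Q.space) : Prop where
  isCorep : Q.IsUnitaryCorep U
  /-- `U` commutes with `D ⊗ 1`. -/
  comm_D : CommutesWith U (amplD T.D Q.space)
  /-- `U` commutes with `γ ⊗ 1`. -/
  comm_γ : U ∘L mapL T.γ 1 = mapL T.γ 1 ∘L U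
  /-- `(J ⊗ *) U (ξ ⊗ 1) = U (J ξ ⊗ 1)`. -/
  comm_J : ∀ ξ : H, IsJStar T.J (U ∘L ket Q.space ξ) (U ∘L ket Q.space (T.J ξ))
  /-- `(id ⊗ φ) Ad_U(a) ∈ A''` with `Ad_U(a) = U (a ⊗ 1) U*`. -/
  adjoint_mem : ∀ a ∈ T.alg, ∀ φ, Q.IsState φ → ∃ S ∈ T.doubleCommutant,
    ∀ η ξ : H, ∃ h : slice (U ∘L mapL a 1 ∘L ContinuousLinearMap.adjoint U) η ξ ∈ Q.alg,
      ⟪η, S ξ⟫_ℂ = φ ⟨_, h⟩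

/-- `(Q, U)` is the quantum group of orientation and real structure preserving isometries
(the universal object): it coacts on the triple, and for every other
`(Q', U')` there is a unique morphism `φ : Q → Q'` with `(id ⊗ φ) U = U'`. -/
structure IsQISO (Q : CompactQuantumGroup.{v})
    (U : H ⊗̂ Q.space →L[ℂ] H ⊗̂ Q.space) : Prop where
  isCoaction : T.IsCoaction Q U
  universal : ∀ (Q' : CompactQuantumGroup.{v}) (U' : H ⊗̂ Q'.space →L[ℂ] H ⊗̂ Q'.space)
    (hU' : T.IsCoaction Q' U'), ∃! φ : Q.alg →⋆ₐ[ℂ] Q'.alg, Q.IsMorphism Q' φ ∧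
      ∀ η ξ : H, φ (Q.coeff isCoaction.isCorep.isMultiplier η ξ) =
        Q'.coeff hU'.isCorep.isMultiplier η ξ

end Defs

/-! ### Products -/

section Product

variable {H₁ : Type u₁} [NormedAddCommGroup H₁] [InnerProductSpace ℂ H₁] [CompleteSpace H₁]
  {H₂ : Type u₂} [NormedAddCommGroup H₂] [InnerProductSpace ℂ H₂] [CompleteSpace H₂]

theorem mapL_comp_mapL (a a' : H₁ →L[ℂ] H₁) (b b' : H₂ →L[ℂ] H₂) :
    mapL a b * mapL a' b' = mapL (a * a') (b * b') := by
  refine ContinuousLinearMap.ext fun x => ?_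
  induction x using (denseRange_incl (H := H₁) (K := H₂)).induction_on with
  | hp => exact isClosed_eq (ContinuousLinearMap.continuous _) (ContinuousLinearMap.continuous _)
  | ih x =>
    rw [mul_apply_eq_comp, mapL_incl, mapL_incl, mapL_incl]
    congr 1
    exact (LinearMap.congr_fun (TensorProduct.map_comp _ _ _ _) x).symm

theorem star_mapL (a : H₁ →L[ℂ] H₁) (b : H₂ →L[ℂ] H₂) :
    star (mapL a b) = mapL (star a) (star b) := by
  symm
  rw [ContinuousLinearMap.star_eq_adjoint (mapL a b), ContinuousLinearMap.eq_adjoint_iff]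
  intro x y
  induction x using (denseRange_incl (H := H₁) (K := H₂)).induction_on with
  | hp => exact isClosed_eq (by fun_prop) (by fun_prop)
  | ih x =>
    induction y using (denseRange_incl (H := H₁) (K := H₂)).induction_on with
    | hp => exact isClosed_eq (by fun_prop) (by fun_prop)
    | ih y =>
      rw [mapL_incl, mapL_incl, LinearIsometry.inner_map_map, LinearIsometry.inner_map_map]
      induction x using TensorProduct.induction_on with
      | zero => simp
      | add p q hp hq => simp only [map_add, inner_add_left, hp, hq]
      | tmul p q =>
        induction y using TensorProduct.induction_on with
        | zero => simp
        | add p q hp hq => simp only [map_add, inner_add_right, hp, hq]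
        | tmul p q =>
          simp [ContinuousLinearMap.star_eq_adjoint, ContinuousLinearMap.adjoint_inner_left]

/-- The algebraic tensor product `A ⊗ B`, acting on the Hilbert space tensor product: the finite
sums of operators `a ⊗ b`. -/
def tensorAlg (A : StarSubalgebra ℂ (H₁ →L[ℂ] H₁)) (B : StarSubalgebra ℂ (H₂ →L[ℂ] H₂)) :
    StarSubalgebra ℂ (H₁ ⊗̂ H₂ →L[ℂ] H₁ ⊗̂ H₂) where
  toSubalgebra := (Submodule.span ℂ {S | ∃ a ∈ A, ∃ b ∈ B, S = mapL a b}).toSubalgebra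
    (Submodule.subset_span ⟨1, A.one_mem, 1, B.one_mem, by
      refine ContinuousLinearMap.ext fun x => ?_
      induction x using (denseRange_incl (H := H₁) (K := H₂)).induction_on with
      | hp =>
        exact isClosed_eq (ContinuousLinearMap.continuous _) (ContinuousLinearMap.continuous _)
      | ih x =>
        rw [mapL_incl]
        exact congrArg (incl H₁ H₂) (LinearMap.congr_fun TensorProduct.map_id x).symm⟩)
    (by
      intro x y hx hy
      have hxy := Submodule.mul_mem_mul hx hy
      rw [Submodule.span_mul_span] at hxy
      refine Submodule.span_mono ?_ hxy
      rintro _ ⟨_, ⟨a, ha, b, hb, rfl⟩, _, ⟨a', ha', b', hb', rfl⟩, rfl⟩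
      exact ⟨a * a', A.mul_mem ha ha', b * b', B.mul_mem hb hb', mapL_comp_mapL _ _ _ _⟩)
  star_mem' := by
    intro x hx
    change x ∈ Submodule.span ℂ _ at hx
    change star x ∈ Submodule.span ℂ _
    induction hx using Submodule.span_induction with
    | mem x hx =>
      obtain ⟨a, ha, b, hb, rfl⟩ := hx
      exact Submodule.subset_span
        ⟨star a, A.star_mem' ha, star b, B.star_mem' hb, star_mapL a b⟩
    | zero => rw [star_zero]; exact Submodule.zero_mem _
    | add x y _ _ hx hy => rw [star_add]; exact Submodule.add_mem _ hx hy
    | smul c x _ hx => rw [star_smul]; exact Submodule.smul_mem _ _ hx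

/-- The product triple `(A₁ ⊗ A₂, H₁ ⊗ H₂, D₁ ⊗ γ₂ + 1 ⊗ D₂, γ₁ ⊗ γ₂, J₁ ⊗ J₂)`. -/
def prod (T₁ : SpectralData H₁) (T₂ : SpectralData H₂) : SpectralData (H₁ ⊗̂ H₂) where
  alg := tensorAlg T₁.alg T₂.alg
  D := prodD T₁.D T₂.γ T₂.D
  γ := mapL T₁.γ T₂.γ
  J := antilinearMap T₁.J T₂.J

end Product

end SpectralData

end

/-! Since `H₂` is finite-dimensional, an orthonormal basis `e` with matrix units `E i j` writes `U`
as the finite sum of `E i j ⊗ u i j`, where the slices `u i j` lie in `Q`. Hence `1 ⊗ U` is the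
finite sum of `(1 ⊗ E i j) ⊗ u i j` (`ampl_eq_sum`), even when `H₁` is infinite-dimensional.
Ampliation is moreover a unital *-homomorphism (`ampl_mul`, `star_ampl`, `ampl_one`), and `1 ⊗ U`
commutes with every `a ⊗ 1 ⊗ 1` (`commute_ampl`). Each condition on `1 ⊗ U` thereby reduces to the
same condition on `U`.

Corepresentation: the finite sum is visibly a multiplier, and `(1 ⊗ U)₁₂ (1 ⊗ U)₁₃ = 1 ⊗ U₁₂ U₁₃`
(`isUnitaryCorep_ampl`).

Dirac operator: `D₂` is densely defined on a finite-dimensional space, so it is a bounded operator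
`B`, and `U` commutes with `B ⊗ 1` and `γ₂ ⊗ 1`. The finite sum keeps the algebraic domain of `D₁ ⊗
γ₂ + 1 ⊗ D₂` invariant, so `1 ⊗ U` and its adjoint preserve the graph, and by continuity its closure
(`commutesWith_ampl`).

Real structure: on simple tensors a slice of `1 ⊗ U` is a scalar times a slice of `U`; `J₁`
conjugates the scalar and `J₂` takes the adjoint of the slice (`isJStar_ampl`).

Algebra: conjugating `a₁ ⊗ a₂` by `1 ⊗ U` gives `a₁ ⊗ Ad_U(a₂)`, and a state turns this into `a₁ ⊗
S` with `S ∈ A₂''`. Such an operator lies in `(A₁ ⊗ A₂)''` (`mapL_mem_doubleCommutant`,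
`exists_slice_eq_ampl`).

The universal pair is covered because it is in particular a pair that coacts. -/

namespace HilbertTensor

variable {H K L : Type*}
  [NormedAddCommGroup H] [InnerProductSpace ℂ H]
  [NormedAddCommGroup K] [InnerProductSpace ℂ K]
  [NormedAddCommGroup L] [InnerProductSpace ℂ L]

/-! ### Simple tensors -/

theorem tmul_add (ξ : H) (k k' : K) : tmul ξ (k + k') = tmul ξ k + tmul ξ k' := by
  simp [tmul, TensorProduct.tmul_add]

theorem add_tmul (ξ ξ' : H) (k : K) : tmul (ξ + ξ') k = tmul ξ k + tmul ξ' k := by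
  simp [tmul, TensorProduct.add_tmul]

theorem tmul_smul (c : ℂ) (ξ : H) (k : K) : tmul ξ (c • k) = c • tmul ξ k := by
  simp [tmul]

theorem smul_tmul (c : ℂ) (ξ : H) (k : K) : tmul (c • ξ) k = c • tmul ξ k := by
  simp only [tmul, ← TensorProduct.smul_tmul', map_smul]

theorem inner_tmul (ξ ξ' : H) (k k' : K) :
    ⟪tmul ξ k, tmul ξ' k'⟫_ℂ = ⟪ξ, ξ'⟫_ℂ * ⟪k, k'⟫_ℂ := by
  simp [tmul]

/-- The operator `ξ ↦ ξ ⊗ k`. -/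
noncomputable def ketRight (H : Type*) [NormedAddCommGroup H] [InnerProductSpace ℂ H] (k : K) :
    H →L[ℂ] H ⊗̂ K :=
  ((flip K H).toContinuousLinearEquiv : _ →L[ℂ] _) ∘L ket H k

theorem ketRight_apply (ξ : H) (k : K) : ketRight H k ξ = tmul ξ k :=
  flip_tmul k ξ

theorem continuousLinearMap_ext {σ : ℂ →+* ℂ} {E : Type*} [NormedAddCommGroup E]
    [NormedSpace ℂ E] {S T : H ⊗̂ K →SL[σ] E}
    (h : ∀ ξ k, S (tmul ξ k) = T (tmul ξ k)) : S = T := by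
  refine ContinuousLinearMap.ext fun x => ?_
  induction x using (denseRange_incl (H := H) (K := K)).induction_on with
  | hp => exact isClosed_eq S.continuous T.continuous
  | ih x =>
    induction x using TensorProduct.induction_on with
    | zero => simp
    | add a b ha hb => simp only [map_add, ha, hb]
    | tmul ξ k => exact h ξ k

/-- Vectors of the completed factor `H ⊗̂ K` need not be sums of simple tensors. Fixing the last
vector with `ketRight` leaves a bounded operator on that factor, to which the two-fold case applies.
-/
theorem continuousLinearMap_ext_left {E : Type*} [NormedAddCommGroup E]
    [NormedSpace ℂ E] {S T : (H ⊗̂ K) ⊗̂ L →L[ℂ] E}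
    (h : ∀ ξ k l, S (tmul (tmul ξ k) l) = T (tmul (tmul ξ k) l)) : S = T := by
  refine continuousLinearMap_ext fun w l => ?_
  have : S ∘L ketRight (H ⊗̂ K) l = T ∘L ketRight (H ⊗̂ K) l :=
    continuousLinearMap_ext fun ξ k => by simpa [ketRight_apply] using h ξ k l
  simpa [ketRight_apply] using DFunLike.congr_fun this w

theorem continuousLinearMap_ext_right {E : Type*} [NormedAddCommGroup E]
    [NormedSpace ℂ E] {S T : H ⊗̂ (K ⊗̂ L) →L[ℂ] E}
    (h : ∀ ξ k l, S (tmul ξ (tmul k l)) = T (tmul ξ (tmul k l))) : S = T := by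
  refine continuousLinearMap_ext fun ξ w => ?_
  have : S ∘L ket (K ⊗̂ L) ξ = T ∘L ket (K ⊗̂ L) ξ :=
    continuousLinearMap_ext fun k l => by simpa [ket_apply] using h ξ k l
  simpa [ket_apply] using DFunLike.congr_fun this w

/-! ### Linearity of operations on operators -/

theorem mapL_one_one : mapL (1 : H →L[ℂ] H) (1 : K →L[ℂ] K) = 1 :=
  continuousLinearMap_ext fun ξ k => by rw [mapL_tmul]; rfl

theorem add_mapL (a a' : H →L[ℂ] H) (b : K →L[ℂ] K) : mapL (a + a') b = mapL a b + mapL a' b :=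
  continuousLinearMap_ext fun ξ k => by simp [mapL_tmul, add_tmul]

theorem mapL_add (a : H →L[ℂ] H) (b b' : K →L[ℂ] K) : mapL a (b + b') = mapL a b + mapL a b' :=
  continuousLinearMap_ext fun ξ k => by simp [mapL_tmul, tmul_add]

theorem smul_mapL (c : ℂ) (a : H →L[ℂ] H) (b : K →L[ℂ] K) : mapL (c • a) b = c • mapL a b :=
  continuousLinearMap_ext fun ξ k => by simp [mapL_tmul, smul_tmul]

theorem mapL_smul (c : ℂ) (a : H →L[ℂ] H) (b : K →L[ℂ] K) : mapL a (c • b) = c • mapL a b :=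
  continuousLinearMap_ext fun ξ k => by simp [mapL_tmul, tmul_smul]

/-- `mapL` as a bilinear map. -/
noncomputable def mapLBilin (H K : Type*) [NormedAddCommGroup H] [InnerProductSpace ℂ H]
    [NormedAddCommGroup K] [InnerProductSpace ℂ K] :
    (H →L[ℂ] H) →ₗ[ℂ] (K →L[ℂ] K) →ₗ[ℂ] (H ⊗̂ K →L[ℂ] H ⊗̂ K) :=
  LinearMap.mk₂ ℂ mapL add_mapL smul_mapL mapL_add mapL_smul

theorem sum_mapL {ι : Type*} (s : Finset ι) (a : ι → H →L[ℂ] H) (b : K →L[ℂ] K) :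
    mapL (∑ i ∈ s, a i) b = ∑ i ∈ s, mapL (a i) b :=
  map_sum ((mapLBilin H K).flip b) a s

theorem mapL_sum {ι : Type*} (s : Finset ι) (a : H →L[ℂ] H) (b : ι → K →L[ℂ] K) :
    mapL a (∑ i ∈ s, b i) = ∑ i ∈ s, mapL a (b i) :=
  map_sum (mapLBilin H K a) b s

/-! ### Ampliations -/

theorem assoc_symm_tmul (ξ : H) (k : K) (l : L) :
    (assoc H K L).symm (tmul ξ (tmul k l)) = tmul (tmul ξ k) l := by
  rw [← assoc_tmul, LinearIsometryEquiv.symm_apply_apply]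

theorem ampl_apply (T : K ⊗̂ L →L[ℂ] K ⊗̂ L) (x : (H ⊗̂ K) ⊗̂ L) :
    ampl H T x =
      (assoc H K L).symm (mapL (ContinuousLinearMap.id ℂ H) T (assoc H K L x)) := rfl

theorem ampl_mapL (a : K →L[ℂ] K) (b : L →L[ℂ] L) :
    ampl H (mapL a b) = mapL (mapL 1 a) b :=
  continuousLinearMap_ext_left fun ξ k l => by
    simp [ampl_apply, assoc_tmul, mapL_tmul, assoc_symm_tmul]

theorem ampl_sum {ι : Type*} (s : Finset ι) (T : ι → K ⊗̂ L →L[ℂ] K ⊗̂ L) :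
    ampl H (∑ i ∈ s, T i) = ∑ i ∈ s, ampl H (T i) := by
  refine ContinuousLinearMap.ext fun x => ?_
  simp [ampl_apply, mapL_sum]

theorem ampl_one : ampl H (1 : K ⊗̂ L →L[ℂ] K ⊗̂ L) = 1 := by
  rw [← mapL_one_one, ampl_mapL, mapL_one_one, mapL_one_one]

/-- Rebracketing separates the leg `H` from `K ⊗̂ L`. This makes `mapL_comp_mapL` applicable against
`1 ⊗ T` for `T` that is not a simple tensor. -/
theorem mapL_mapL_one (a : H →L[ℂ] H) (x : (H ⊗̂ K) ⊗̂ L) :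
    mapL (mapL a (1 : K →L[ℂ] K)) (1 : L →L[ℂ] L) x =
      (assoc H K L).symm (mapL a (1 : K ⊗̂ L →L[ℂ] K ⊗̂ L) (assoc H K L x)) := by
  have h : mapL (mapL a (1 : K →L[ℂ] K)) (1 : L →L[ℂ] L) =
      ((assoc H K L).symm.toContinuousLinearEquiv : _ →L[ℂ] _) ∘L
          mapL a (1 : K ⊗̂ L →L[ℂ] K ⊗̂ L) ∘L
        ((assoc H K L).toContinuousLinearEquiv : _ →L[ℂ] _) :=
    continuousLinearMap_ext_left fun ξ k l => by
      simp [mapL_tmul, assoc_tmul, assoc_symm_tmul]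
  rw [h]; rfl

theorem leg12_mapL (a : H →L[ℂ] H) (b : K →L[ℂ] K) : leg12 (mapL a b) = mapL a (mapL b 1) :=
  continuousLinearMap_ext_right fun ξ k l => by
    simp [leg12, assocConj, mapL_tmul, assoc_symm_tmul, assoc_tmul]

theorem leg13_mapL (a : H →L[ℂ] H) (b : K →L[ℂ] K) : leg13 (mapL a b) = mapL a (mapL 1 b) :=
  continuousLinearMap_ext_right fun ξ k l => by
    simp [leg13, leg12_mapL, mapL_tmul, flip_tmul]

theorem leg12_sum {ι : Type*} (s : Finset ι) (T : ι → H ⊗̂ K →L[ℂ] H ⊗̂ K) :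
    leg12 (∑ i ∈ s, T i) = ∑ i ∈ s, leg12 (T i) := by
  refine ContinuousLinearMap.ext fun x => ?_
  simp [leg12, assocConj, sum_mapL]

theorem leg13_sum {ι : Type*} (s : Finset ι) (T : ι → H ⊗̂ K →L[ℂ] H ⊗̂ K) :
    leg13 (∑ i ∈ s, T i) = ∑ i ∈ s, leg13 (T i) := by
  refine ContinuousLinearMap.ext fun x => ?_
  simp [leg13, leg12_sum]

section Complete

variable [CompleteSpace H] [CompleteSpace K] [CompleteSpace L]

theorem ampl_mul (S T : K ⊗̂ L →L[ℂ] K ⊗̂ L) : ampl H (S * T) = ampl H S * ampl H T := by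
  refine ContinuousLinearMap.ext fun x => ?_
  have h := DFunLike.congr_fun
    (SpectralData.mapL_comp_mapL (1 : H →L[ℂ] H) 1 S T) (assoc H K L x)
  rw [one_mul] at h
  change (assoc H K L).symm (mapL 1 (S * T) (assoc H K L x)) =
    (assoc H K L).symm (mapL 1 S (assoc H K L ((assoc H K L).symm _)))
  rw [← h, LinearIsometryEquiv.apply_symm_apply]
  rfl

theorem star_ampl (T : K ⊗̂ L →L[ℂ] K ⊗̂ L) : star (ampl H T) = ampl H (star T) := by
  symm
  rw [ContinuousLinearMap.star_eq_adjoint (ampl H T), ContinuousLinearMap.eq_adjoint_iff]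
  intro x y
  have h := SpectralData.star_mapL (1 : H →L[ℂ] H) T
  rw [star_one, ContinuousLinearMap.star_eq_adjoint] at h
  change ⟪(assoc H K L).symm (mapL 1 (star T) (assoc H K L x)), y⟫_ℂ =
    ⟪x, (assoc H K L).symm (mapL 1 T (assoc H K L y))⟫_ℂ
  rw [← h, LinearIsometryEquiv.inner_map_eq_flip, LinearIsometryEquiv.symm_symm,
    ContinuousLinearMap.adjoint_inner_left, ← LinearIsometryEquiv.inner_map_eq_flip]

theorem ampl_mem_unitary {U : K ⊗̂ L →L[ℂ] K ⊗̂ L}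
    (hU : U ∈ unitary (K ⊗̂ L →L[ℂ] K ⊗̂ L)) :
    ampl H U ∈ unitary ((H ⊗̂ K) ⊗̂ L →L[ℂ] (H ⊗̂ K) ⊗̂ L) := by
  rw [Unitary.mem_iff] at hU ⊢
  rw [star_ampl, ← ampl_mul, ← ampl_mul, hU.1, hU.2]
  exact ⟨ampl_one, ampl_one⟩

theorem commute_ampl (a : H →L[ℂ] H) (T : K ⊗̂ L →L[ℂ] K ⊗̂ L) :
    Commute (mapL (mapL a (1 : K →L[ℂ] K)) (1 : L →L[ℂ] L)) (ampl H T) := by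
  refine ContinuousLinearMap.ext fun x => ?_
  have h := SpectralData.mapL_comp_mapL a 1 1 T
  rw [mul_one, one_mul] at h
  have h' := SpectralData.mapL_comp_mapL 1 a T 1
  rw [mul_one, one_mul] at h'
  have e := DFunLike.congr_fun (h.trans h'.symm) (assoc H K L x)
  change mapL (mapL a 1) 1 ((assoc H K L).symm (mapL 1 T (assoc H K L x))) =
    (assoc H K L).symm (mapL 1 T (assoc H K L (mapL (mapL a 1) 1 x)))
  rw [mapL_mapL_one, mapL_mapL_one, LinearIsometryEquiv.apply_symm_apply,
    LinearIsometryEquiv.apply_symm_apply]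
  exact congrArg _ e

/-! ### Slices -/

theorem adjoint_ket_tmul (η ξ : H) (k : K) :
    ContinuousLinearMap.adjoint (ket K η) (tmul ξ k) = ⟪η, ξ⟫_ℂ • k := by
  refine ext_inner_left ℂ fun k' => ?_
  rw [ContinuousLinearMap.adjoint_inner_right, ket_apply, inner_tmul, inner_smul_right]

theorem slice_sum {ι : Type*} (s : Finset ι) (T : ι → H ⊗̂ K →L[ℂ] H ⊗̂ K) (η ξ : H) :
    slice (∑ i ∈ s, T i) η ξ = ∑ i ∈ s, slice (T i) η ξ := by
  refine ContinuousLinearMap.ext fun x => ?_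
  simp [slice]

/-- Together with `slice_mapL_one_mul`, this makes slicing a bimodule map over the operators on the
second leg, so commutation with `1 ⊗ b` can be tested slice by slice. -/
theorem slice_mul_mapL_one (T : H ⊗̂ K →L[ℂ] H ⊗̂ K) (b : K →L[ℂ] K) (η ξ : H) :
    slice (T * mapL 1 b) η ξ = slice T η ξ * b := by
  refine ContinuousLinearMap.ext fun k => ext_inner_left ℂ fun k' => ?_
  rw [mul_apply_eq_comp, inner_slice, inner_slice, mul_apply_eq_comp,
    mapL_tmul]
  rfl

theorem slice_mapL_one_mul (T : H ⊗̂ K →L[ℂ] H ⊗̂ K) (b : K →L[ℂ] K) (η ξ : H) :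
    slice (mapL 1 b * T) η ξ = b * slice T η ξ := by
  refine ContinuousLinearMap.ext fun k => ext_inner_left ℂ fun k' => ?_
  have h := SpectralData.star_mapL (1 : H →L[ℂ] H) b
  rw [star_one] at h
  rw [mul_apply_eq_comp, inner_slice, mul_apply_eq_comp,
    ← ContinuousLinearMap.adjoint_inner_left, ← ContinuousLinearMap.star_eq_adjoint, h, mapL_tmul,
    ← ContinuousLinearMap.adjoint_inner_left b, inner_slice]
  rfl

/-- Operators with equal slices are equal. -/
theorem slice_injective {S T : H ⊗̂ K →L[ℂ] H ⊗̂ K}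
    (h : ∀ η ξ : H, slice S η ξ = slice T η ξ) : S = T := by
  refine continuousLinearMap_ext fun ξ k => ?_
  refine (denseRange_incl (H := H) (K := K)).eq_of_inner_right (𝕜 := ℂ) fun x => ?_
  induction x using TensorProduct.induction_on with
  | zero => simp
  | add a b ha hb => rw [map_add, inner_add_left, inner_add_left, ha, hb]
  | tmul η l =>
    change ⟪tmul η l, S (tmul ξ k)⟫_ℂ = ⟪tmul η l, T (tmul ξ k)⟫_ℂ
    rw [← inner_slice, ← inner_slice, h]

theorem slice_ampl_tmul (T : K ⊗̂ L →L[ℂ] K ⊗̂ L) (η ξ : H) (y y' : K) :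
    slice (ampl H T) (tmul η y) (tmul ξ y') = ⟪η, ξ⟫_ℂ • slice T y y' := by
  refine ContinuousLinearMap.ext fun l => ext_inner_left ℂ fun l' => ?_
  rw [inner_slice, ampl_apply, ← LinearIsometryEquiv.inner_map_eq_flip, assoc_tmul, assoc_tmul,
    mapL_tmul, inner_tmul, smul_apply, inner_smul_right, inner_slice]
  rfl

/-- In this ket-bra form, sandwiching an operator between two such factors produces a slice in the
middle. -/
theorem mapL_rankOne (x y : H) (b : K →L[ℂ] K) :
    mapL (InnerProductSpace.rankOne ℂ x y) b =
      ket K x ∘L b ∘L ContinuousLinearMap.adjoint (ket K y) :=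
  continuousLinearMap_ext fun ξ k => by
    simp [mapL_tmul, adjoint_ket_tmul, ket_apply, smul_tmul]

variable {ι : Type*} [Fintype ι]

theorem sum_mapL_rankOne (e : OrthonormalBasis ι ℂ H) :
    ∑ i, mapL (InnerProductSpace.rankOne ℂ (e i) (e i)) (1 : K →L[ℂ] K) = 1 := by
  rw [← sum_mapL, ← mapL_one_one]
  congr 1
  refine ContinuousLinearMap.ext fun x => ?_
  simp [e.sum_repr']

theorem eq_sum_rankOne (e : OrthonormalBasis ι ℂ H) (S : H →L[ℂ] H) :
    S = ∑ i, ∑ j, ⟪e i, S (e j)⟫_ℂ • InnerProductSpace.rankOne ℂ (e i) (e j) := by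
  refine ContinuousLinearMap.ext fun x => ?_
  simp only [sum_apply, smul_apply, InnerProductSpace.rankOne_apply]
  conv_lhs => rw [← e.sum_repr' (S x)]
  refine Finset.sum_congr rfl fun i _ => ?_
  conv_lhs => rw [← e.sum_repr' x]
  simp only [map_sum, map_smul, inner_sum, inner_smul_right, Finset.sum_smul, smul_smul]
  exact Finset.sum_congr rfl fun j _ => by rw [mul_comm]

/-- Over a finite-dimensional first leg, an operator is the matrix of its slices. -/
theorem eq_sum_mapL_slice (e : OrthonormalBasis ι ℂ H) (T : H ⊗̂ K →L[ℂ] H ⊗̂ K) :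
    T = ∑ i, ∑ j, mapL (InnerProductSpace.rankOne ℂ (e i) (e j)) (slice T (e i) (e j)) := by
  calc
    T = 1 * T * 1 := by rw [one_mul, mul_one]
    _ = _ := by
      rw [← sum_mapL_rankOne (K := K) e, Finset.sum_mul, Finset.sum_mul_sum]
      refine Finset.sum_congr rfl fun i _ => Finset.sum_congr rfl fun j _ => ?_
      -- Between the resolutions of the identity on both sides, the inner bra, `T` and the inner ket
      -- compose to the slice; only reassociation remains.
      rw [mapL_rankOne, mapL_rankOne, mapL_rankOne]
      rfl

/-- Only the middle leg `K` has to be finite-dimensional: the slices are taken for `T` itself, so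
nothing is expanded along `H`. -/
theorem ampl_eq_sum (e : OrthonormalBasis ι ℂ K) (T : K ⊗̂ L →L[ℂ] K ⊗̂ L) :
    ampl H T = ∑ i, ∑ j,
      mapL (mapL 1 (InnerProductSpace.rankOne ℂ (e i) (e j))) (slice T (e i) (e j)) := by
  conv_lhs => rw [eq_sum_mapL_slice e T]
  simp only [ampl_sum, ampl_mapL]

end Complete

/-! ### Graphs of unbounded operators -/

/-- The algebraic tensor product is spanned by simple tensors, so the graph is too. Statements about
the operator can then be checked on pairs of generators, without handling its domain. -/
theorem graph_pmapOfDomain (E : Submodule ℂ H) (F : Submodule ℂ K) (f : E ⊗[ℂ] F →ₗ[ℂ] H ⊗̂ K) :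
    (pmapOfDomain E F f).graph =
      Submodule.span ℂ {p | ∃ (x : E) (y : F), p = (tmul (x : H) (y : K), f (x ⊗ₜ y))} := by
  let g := (domIncl E F).toLinearMap
  have hg : Function.Injective g := (domIncl E F).isometry.injective
  have key : (pmapOfDomain E F f).graph = LinearMap.range (g.prod f) := by
    ext p
    rw [LinearPMap.mem_graph_iff]
    constructor
    · rintro ⟨⟨_, z, rfl⟩, h1, h2⟩
      refine ⟨z, Prod.ext h1 (Eq.trans ?_ h2)⟩
      change f z = f ((LinearEquiv.ofInjective g hg).symm ⟨g z, _⟩)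
      congr 1
      rw [LinearEquiv.eq_symm_apply]
      rfl
    · rintro ⟨z, rfl⟩
      refine ⟨⟨g z, z, rfl⟩, rfl, ?_⟩
      change f ((LinearEquiv.ofInjective g hg).symm ⟨g z, _⟩) = f z
      congr 1
      rw [LinearEquiv.symm_apply_eq]
      rfl
  rw [key, LinearMap.range_eq_map, ← TensorProduct.span_tmul_eq_top, Submodule.map_span]
  congr 1
  ext p
  constructor
  · rintro ⟨_, ⟨x, y, rfl⟩, rfl⟩
    exact ⟨x, y, rfl⟩
  · rintro ⟨x, y, rfl⟩
    exact ⟨_, ⟨x, y, rfl⟩, rfl⟩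

/-- The graph of the algebraic `D ⊗ 1` on `dom D ⊗ K`. -/
noncomputable def amplGraph (D : H →ₗ.[ℂ] H) (K : Type*) [NormedAddCommGroup K] [InnerProductSpace ℂ K] :
    Submodule ℂ ((H ⊗̂ K) × (H ⊗̂ K)) :=
  Submodule.span ℂ {p | ∃ (x : D.domain) (k : K), p = (tmul (x : H) k, tmul (D x) k)}

theorem tmul_mem_amplGraph {D : H →ₗ.[ℂ] H} {x x' : H} (h : (x, x') ∈ D.graph) (k : K) :
    (tmul x k, tmul x' k) ∈ amplGraph D K := by
  obtain ⟨y, rfl, rfl⟩ := (LinearPMap.mem_graph_iff D).1 h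
  exact Submodule.subset_span ⟨y, k, rfl⟩

theorem exists_amplD_eq_closure (D : H →ₗ.[ℂ] H) (K : Type*) [NormedAddCommGroup K]
    [InnerProductSpace ℂ K] :
    ∃ f : H ⊗̂ K →ₗ.[ℂ] H ⊗̂ K, amplD D K = f.closure ∧ f.graph = amplGraph D K := by
  refine ⟨_, rfl, ?_⟩
  rw [graph_pmapOfDomain, amplGraph]
  congr 1
  ext p
  constructor
  · rintro ⟨x, y, rfl⟩
    exact ⟨x, y, rfl⟩
  · rintro ⟨x, y, rfl⟩
    exact ⟨x, ⟨y, trivial⟩, rfl⟩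

theorem amplGraph_le_graph_amplD (D : H →ₗ.[ℂ] H) : amplGraph D K ≤ (amplD D K).graph := by
  obtain ⟨f, h, h'⟩ := exists_amplD_eq_closure D K
  rw [h, ← h']
  exact LinearPMap.le_graph_of_le f.le_closure

/-- A bounded operator that preserves a graph preserves its topological closure. Closability need
not be known in advance. -/
theorem mem_graph_closure_of_mem_graph {f : H →ₗ.[ℂ] H} (V : H →L[ℂ] H)
    (hV : ∀ p ∈ f.graph, (V p.1, V p.2) ∈ f.graph) :
    ∀ p ∈ f.closure.graph, (V p.1, V p.2) ∈ f.closure.graph := by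
  by_cases hf : f.IsClosable
  · rw [← hf.graph_closure_eq_closure_graph]
    intro p hp
    exact map_mem_closure (f := fun p : H × H => (V p.1, V p.2)) (by fun_prop) hp hV
  -- By convention the closure of a non-closable operator is the operator itself.
  · rwa [LinearPMap.closure_def' hf]

theorem mem_graph_amplD {D : H →ₗ.[ℂ] H} (V : H ⊗̂ K →L[ℂ] H ⊗̂ K)
    (hV : ∀ (x : D.domain) (k : K), (V (tmul (x : H) k), V (tmul (D x) k)) ∈ amplGraph D K) :
    ∀ p ∈ (amplD D K).graph, (V p.1, V p.2) ∈ (amplD D K).graph := by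
  obtain ⟨f, h, h'⟩ := exists_amplD_eq_closure D K
  rw [h]
  refine mem_graph_closure_of_mem_graph V ?_
  rw [h']
  suffices amplGraph D K ≤ (amplGraph D K).comap (V.prodMap V).toLinearMap from this
  refine Submodule.span_le.2 ?_
  rintro _ ⟨x, k, rfl⟩
  exact hV x k

theorem graph_prodD (D₁ : H →ₗ.[ℂ] H) (γ₂ : K →L[ℂ] K) (D₂ : K →ₗ.[ℂ] K) :
    (prodD D₁ γ₂ D₂).graph = Submodule.span ℂ {p | ∃ (x : D₁.domain) (y : D₂.domain),
      p = (tmul (x : H) (y : K), tmul (D₁ x) (γ₂ y) + tmul (x : H) (D₂ y))} := by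
  rw [prodD, graph_pmapOfDomain]
  congr 1
  ext p
  simp [tmul]

end HilbertTensor

open HilbertTensor

/-! ### Commutation with unbounded operators through their graphs -/

namespace SpectralData

/-- Invariance under the adjoint supplies the reverse inclusion of domains, since `x = U* (U x)`;
the equality of values is single-valuedness of the graph. -/
theorem commutesWith_of_mem_graph {K : Type v} [NormedAddCommGroup K] [InnerProductSpace ℂ K]
    [CompleteSpace K] {U : K →L[ℂ] K} (hU : U ∈ unitary (K →L[ℂ] K)) {S : K →ₗ.[ℂ] K}
    (h : ∀ p ∈ S.graph, (U p.1, U p.2) ∈ S.graph)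
    (h' : ∀ p ∈ S.graph, (star U p.1, star U p.2) ∈ S.graph) : CommutesWith U S := by
  have hUU : ∀ x, star U (U x) = x := fun x => DFunLike.congr_fun (Unitary.mem_iff.1 hU).1 x
  refine ⟨fun x => ⟨fun hx => ?_, fun hx => ?_⟩, fun x hx => ?_⟩
  · have := LinearPMap.mem_domain_of_mem_graph (h' _ (S.mem_graph ⟨U x, hx⟩))
    rwa [hUU] at this
  · exact LinearPMap.mem_domain_of_mem_graph (h _ (S.mem_graph ⟨x, hx⟩))
  · exact S.mem_graph_snd_inj (S.mem_graph ⟨U x, hx⟩) (h _ (S.mem_graph x)) rfl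

variable {H₁ : Type u₁} [NormedAddCommGroup H₁] [InnerProductSpace ℂ H₁] [CompleteSpace H₁]
  {H₂ : Type u₂} [NormedAddCommGroup H₂] [InnerProductSpace ℂ H₂] [CompleteSpace H₂]
  {K : Type v} [NormedAddCommGroup K] [InnerProductSpace ℂ K] [CompleteSpace K]

theorem star_commute_of_mem_unitary {U X : K →L[ℂ] K} (hU : U ∈ unitary (K →L[ℂ] K))
    (h : Commute U X) : Commute (star U) X := by
  obtain ⟨h1, h2⟩ := Unitary.mem_iff.1 hU
  calc star U * X = star U * X * (U * star U) := by rw [h2, mul_one]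
    _ = star U * (X * U) * star U := by simp only [mul_assoc]
    _ = star U * (U * X) * star U := by rw [h.eq]
    _ = X * star U := by rw [← mul_assoc, h1, one_mul]

/-! ### The Dirac operator of the product -/

section FiniteDimensional

variable [FiniteDimensional ℂ H₂]

/-- A densely defined operator on a finite-dimensional space is bounded and everywhere defined. -/
theorem exists_graph_eq_of_dense {D : H₂ →ₗ.[ℂ] H₂} (hD : Dense (D.domain : Set H₂)) :
    ∃ B : H₂ →L[ℂ] H₂, ∀ x y, (x, y) ∈ D.graph ↔ y = B x := by
  have htop : D.domain = ⊤ := by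
    rw [← D.domain.closed_of_finiteDimensional.submodule_topologicalClosure_eq]
    exact (Submodule.dense_iff_topologicalClosure_eq_top).1 hD
  let B : H₂ →ₗ[ℂ] H₂ := D.toFun ∘ₗ (LinearEquiv.ofTop D.domain htop).symm.toLinearMap
  refine ⟨LinearMap.toContinuousLinearMap B, fun x y => ?_⟩
  have hx : (x, B x) ∈ D.graph := D.mem_graph ⟨x, htop ▸ trivial⟩
  constructor
  · intro h
    exact D.mem_graph_snd_inj h hx rfl
  · rintro rfl
    exact hx

/-- The finite expansion of `U` shows that `U (y ⊗ k)` stays in the algebraic tensor product, where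
the closed operator is given by `B ⊗ 1`. Comparing this value with the one provided by `hU` gives
the bounded relation. -/
theorem commute_of_commutesWith_amplD {D : H₂ →ₗ.[ℂ] H₂} {B : H₂ →L[ℂ] H₂}
    (hB : ∀ x y, (x, y) ∈ D.graph ↔ y = B x) {U : H₂ ⊗̂ K →L[ℂ] H₂ ⊗̂ K}
    (hU : CommutesWith U (amplD D K)) : Commute U (mapL B 1) := by
  let e := stdOrthonormalBasis ℂ H₂
  have hmem : ∀ (y : H₂) (k : K),
      (tmul y k, mapL B (1 : K →L[ℂ] K) (tmul y k)) ∈ (amplD D K).graph := fun y k => by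
    rw [mapL_tmul]
    exact amplGraph_le_graph_amplD D (tmul_mem_amplGraph ((hB _ _).2 rfl) k)
  have hmemU : ∀ (y : H₂) (k : K),
      (U (tmul y k), mapL B (1 : K →L[ℂ] K) (U (tmul y k))) ∈ (amplD D K).graph := fun y k => by
    have hUy := DFunLike.congr_fun (eq_sum_mapL_slice e U) (tmul y k)
    simp only [sum_apply, mapL_tmul] at hUy
    have := Submodule.sum_mem _ fun i (_ : i ∈ Finset.univ) =>
      Submodule.sum_mem _ fun j (_ : j ∈ Finset.univ) =>
        hmem (InnerProductSpace.rankOne ℂ (e i) (e j) y) (slice U (e i) (e j) k)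
    rw [hUy]
    convert this using 1
    refine Prod.ext ?_ ?_
    · simp [Prod.fst_sum]
    · simp [Prod.snd_sum]
  refine continuousLinearMap_ext fun y k => ?_
  have hz := LinearPMap.mem_domain_of_mem_graph (hmem y k)
  have h1 := (amplD D K).mem_graph ⟨U (tmul y k), (hU.1 _).2 hz⟩
  rw [hU.2 ⟨tmul y k, hz⟩,
    (amplD D K).mem_graph_snd_inj ((amplD D K).mem_graph ⟨tmul y k, hz⟩) (hmem y k) rfl] at h1
  exact (amplD D K).mem_graph_snd_inj h1 (hmemU y k) rfl

/-- If `V` on `H₂ ⊗ K` commutes with `γ₂ ⊗ 1` and `D₂ ⊗ 1`, then `1 ⊗ V` preserves the graph of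
`(D₁ ⊗ γ₂ + 1 ⊗ D₂) ⊗ 1`. -/
theorem ampl_mem_graph_amplD (D₁ : H₁ →ₗ.[ℂ] H₁) {γ₂ : H₂ →L[ℂ] H₂} {D₂ : H₂ →ₗ.[ℂ] H₂}
    {B : H₂ →L[ℂ] H₂} (hB : ∀ x y, (x, y) ∈ D₂.graph ↔ y = B x) {V : H₂ ⊗̂ K →L[ℂ] H₂ ⊗̂ K}
    (hγ : Commute V (mapL γ₂ 1)) (hD : Commute V (mapL B 1)) :
    ∀ p ∈ (amplD (prodD D₁ γ₂ D₂) K).graph,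
      (ampl H₁ V p.1, ampl H₁ V p.2) ∈ (amplD (prodD D₁ γ₂ D₂) K).graph := by
  let e := stdOrthonormalBasis ℂ H₂
  have hgen : ∀ (x : D₁.domain) (y : H₂),
      (tmul (x : H₁) y, tmul (D₁ x) (γ₂ y) + tmul (x : H₁) (B y)) ∈ (prodD D₁ γ₂ D₂).graph := by
    intro x y
    obtain ⟨y, rfl, hy⟩ := (LinearPMap.mem_graph_iff _).1 ((hB y _).2 rfl)
    rw [graph_prodD]
    exact Submodule.subset_span ⟨x, y, by rw [hy]⟩
  -- Used for `C = γ₂` and `C = B`: ampliating the commutation relation moves `C` to the left of `1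
  -- ⊗ V`.
  have hcomm : ∀ (C : H₂ →L[ℂ] H₂), Commute V (mapL C 1) → ∀ (x : H₁) (y : H₂) (k : K),
      ampl H₁ V (tmul (tmul x (C y)) k) = mapL (mapL 1 C) 1 (ampl H₁ V (tmul (tmul x y) k)) := by
    intro C hC x y k
    have h := congrArg (ampl H₁) hC.eq
    rw [ampl_mul, ampl_mul, ampl_mapL] at h
    simpa [mapL_tmul] using DFunLike.congr_fun h (tmul (tmul x y) k)
  have key : ∀ (x : D₁.domain) (y : H₂) (k : K),
      (ampl H₁ V (tmul (tmul (x : H₁) y) k),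
        ampl H₁ V (tmul (tmul (D₁ x) (γ₂ y) + tmul (x : H₁) (B y)) k)) ∈
        amplGraph (prodD D₁ γ₂ D₂) K := by
    intro x y k
    have := Submodule.sum_mem _ fun i (_ : i ∈ Finset.univ) =>
      Submodule.sum_mem _ fun j (_ : j ∈ Finset.univ) =>
        tmul_mem_amplGraph (hgen x (InnerProductSpace.rankOne ℂ (e i) (e j) y))
          (slice V (e i) (e j) k)
    -- With `γ₂` and `B` outside, expanding `V` makes each summand the generator `hgen` at `E i j
    -- y`, tensored with `v i j k`, where `v i j` is a slice of `V`.
    rw [add_tmul, map_add, hcomm _ hγ, hcomm _ hD, ampl_eq_sum e V]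
    convert this using 1
    refine Prod.ext ?_ ?_
    · simp [Prod.fst_sum, mapL_tmul]
    · simp [Prod.snd_sum, mapL_tmul, add_tmul, Finset.sum_add_distrib]
  refine mem_graph_amplD _ fun w k => ?_
  -- For fixed `k` the claim is linear in the pair formed by `w` and its image, so the spanning
  -- pairs of the product graph suffice.
  suffices (prodD D₁ γ₂ D₂).graph ≤ (amplGraph (prodD D₁ γ₂ D₂) K).comap
      ((ampl H₁ V ∘L ketRight _ k).prodMap (ampl H₁ V ∘L ketRight _ k)).toLinearMap by
    simpa [ketRight_apply] using this ((prodD D₁ γ₂ D₂).mem_graph w)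
  rw [graph_prodD]
  refine Submodule.span_le.2 ?_
  rintro _ ⟨x, y, rfl⟩
  have hy : D₂ y = B y := (hB _ _).1 (D₂.mem_graph y)
  simpa [ketRight_apply, hy] using key x y k

theorem commutesWith_ampl {D₁ : H₁ →ₗ.[ℂ] H₁} {γ₂ : H₂ →L[ℂ] H₂} {D₂ : H₂ →ₗ.[ℂ] H₂}
    (hD₂ : Dense (D₂.domain : Set H₂)) {U : H₂ ⊗̂ K →L[ℂ] H₂ ⊗̂ K}
    (hU : U ∈ unitary (H₂ ⊗̂ K →L[ℂ] H₂ ⊗̂ K)) (hγ : Commute U (mapL γ₂ 1))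
    (hD : CommutesWith U (amplD D₂ K)) :
    CommutesWith (ampl H₁ U) (amplD (prodD D₁ γ₂ D₂) K) := by
  obtain ⟨B, hB⟩ := exists_graph_eq_of_dense hD₂
  have hUB := commute_of_commutesWith_amplD hB hD
  refine commutesWith_of_mem_graph (ampl_mem_unitary hU) (ampl_mem_graph_amplD D₁ hB hγ hUB) ?_
  rw [star_ampl]
  exact ampl_mem_graph_amplD D₁ hB (star_commute_of_mem_unitary hU hγ)
    (star_commute_of_mem_unitary hU hUB)

end FiniteDimensional

/-! ### Multipliers and the corepresentation identity -/

section Multiplier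

variable {K : Type v} [NormedAddCommGroup K] [InnerProductSpace ℂ K] [CompleteSpace K]

theorem isMultiplier_sum {Q : Submodule ℂ (K →L[ℂ] K)} {ι : Type*} (s : Finset ι)
    {T : ι → H₁ ⊗̂ K →L[ℂ] H₁ ⊗̂ K} (hT : ∀ i ∈ s, IsMultiplier Q (T i)) :
    IsMultiplier Q (∑ i ∈ s, T i) := by
  intro X hX
  change (∑ i ∈ s, T i) * X ∈ _ ∧ X * (∑ i ∈ s, T i) ∈ _
  rw [Finset.sum_mul, Finset.mul_sum]
  exact ⟨Submodule.sum_mem _ fun i hi => (hT i hi X hX).1,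
    Submodule.sum_mem _ fun i hi => (hT i hi X hX).2⟩

/-- Compact operators form a two-sided ideal and `Q` is an algebra, so the span is preserved, and by
continuity its closure. Here `a` is any bounded operator, as required for `1 ⊗ E i j`, which need
not be compact. -/
theorem isMultiplier_mapL {Q : StarSubalgebra ℂ (K →L[ℂ] K)} (a : H₁ →L[ℂ] H₁)
    {q : K →L[ℂ] K} (hq : q ∈ Q) :
    IsMultiplier (Subalgebra.toSubmodule Q.toSubalgebra) (mapL a q) := by
  intro X hX
  have hleft : Continuous fun X : H₁ ⊗̂ K →L[ℂ] H₁ ⊗̂ K => mapL a q * X := by fun_prop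
  have hright : Continuous fun X : H₁ ⊗̂ K →L[ℂ] H₁ ⊗̂ K => X * mapL a q := by fun_prop
  constructor
  · refine map_mem_closure hleft hX fun Y hY => ?_
    change mapL a q * Y ∈ Submodule.span ℂ _
    induction hY using Submodule.span_induction with
    | mem Y hY =>
      obtain ⟨k, hk, b, hb, rfl⟩ := hY
      rw [mapL_comp_mapL]
      exact Submodule.subset_span ⟨_, IsCompactOperator.clm_comp hk a, _, Q.mul_mem hq hb, rfl⟩
    | zero => rw [mul_zero]; exact Submodule.zero_mem _
    | add Y Z _ _ hY hZ => rw [mul_add]; exact Submodule.add_mem _ hY hZ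
    | smul c Y _ hY => rw [mul_smul_comm]; exact Submodule.smul_mem _ _ hY
  · refine map_mem_closure (f := fun X => X * mapL a q) hright hX fun Y hY => ?_
    change Y * mapL a q ∈ Submodule.span ℂ _
    induction hY using Submodule.span_induction with
    | mem Y hY =>
      obtain ⟨k, hk, b, hb, rfl⟩ := hY
      rw [mapL_comp_mapL]
      exact Submodule.subset_span ⟨_, IsCompactOperator.comp_clm hk a, _, Q.mul_mem hb hq, rfl⟩
    | zero => rw [zero_mul]; exact Submodule.zero_mem _
    | add Y Z _ _ hY hZ => rw [add_mul]; exact Submodule.add_mem _ hY hZ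
    | smul c Y _ hY => rw [smul_mul_assoc]; exact Submodule.smul_mem _ _ hY

end Multiplier

/-- The ampliation `1 ⊗ U` of a unitary corepresentation on a finite-dimensional Hilbert space. -/
theorem isUnitaryCorep_ampl [FiniteDimensional ℂ H₂] {Q : CompactQuantumGroup.{v}}
    {U : H₂ ⊗̂ Q.space →L[ℂ] H₂ ⊗̂ Q.space} (hU : Q.IsUnitaryCorep U) :
    Q.IsUnitaryCorep (ampl H₁ U) := by
  let e := stdOrthonormalBasis ℂ H₂
  have hslice : ∀ i j, slice U (e i) (e j) ∈ Q.alg := fun i j =>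
    hU.isMultiplier.slice_mem Q.alg.one_mem Q.isClosed_alg _ _
  have hmult : IsMultiplier Q.subspace (ampl H₁ U) := by
    rw [ampl_eq_sum e U]
    exact isMultiplier_sum _ fun i _ => isMultiplier_sum _ fun j _ =>
      isMultiplier_mapL _ (hslice i j)
  refine ⟨hmult, ampl_mem_unitary hU.isUnitary, fun η ξ => ?_⟩
  let E := fun i j => InnerProductSpace.rankOne ℂ (e i) (e j)
  have hcoeff : Q.coeff hmult η ξ = ∑ i, ∑ j,
      ⟪η, mapL (1 : H₁ →L[ℂ] H₁) (E i j) ξ⟫_ℂ • Q.coeff hU.isMultiplier (e i) (e j) := by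
    refine Subtype.ext ?_
    push_cast
    change slice (ampl H₁ U) η ξ =
      ∑ i, ∑ j, ⟪η, mapL (1 : H₁ →L[ℂ] H₁) (E i j) ξ⟫_ℂ • slice U (e i) (e j)
    rw [ampl_eq_sum e U]
    simp only [slice_sum, slice_mapL, E]
  have hleg : leg12 (ampl H₁ U) * leg13 (ampl H₁ U) =
      ∑ i, ∑ j, mapL (mapL 1 (E i j)) (slice (leg12 U * leg13 U) (e i) (e j)) := by
    -- Both leg products are expanded in the same coefficients; they differ only by `E i k * E j l`
    -- against `1 ⊗ E i k * E j l`, so the second is the ampliation of the first.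
    have h1 : leg12 U * leg13 U = ∑ i, ∑ j, ∑ k, ∑ l, mapL (E i k * E j l)
        (mapL (slice U (e i) (e k)) 1 * mapL 1 (slice U (e j) (e l))) := by
      conv_lhs => rw [eq_sum_mapL_slice e U]
      simp only [leg12_sum, leg13_sum, leg12_mapL, leg13_mapL, Finset.sum_mul_sum, mapL_comp_mapL,
        E]
    have h2 : leg12 (ampl H₁ U) * leg13 (ampl H₁ U) = ∑ i, ∑ j, ∑ k, ∑ l,
        mapL (mapL 1 (E i k * E j l))
          (mapL (slice U (e i) (e k)) 1 * mapL 1 (slice U (e j) (e l))) := by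
      rw [ampl_eq_sum e U]
      simp only [leg12_sum, leg13_sum, leg12_mapL, leg13_mapL, Finset.sum_mul_sum, mapL_comp_mapL,
        E, mul_one]
    calc
      _ = ampl H₁ (leg12 U * leg13 U) := by
        rw [h2, h1]
        simp only [ampl_sum, ampl_mapL]
      _ = _ := ampl_eq_sum e _
  change _ = slice (leg12 (ampl H₁ U) * leg13 (ampl H₁ U)) η ξ
  rw [hcoeff, hleg]
  -- The coefficients of `1 ⊗ U` are linear combinations of those of `U`, so linearity of the
  -- comultiplication reduces the identity to the one for `U`.
  simp only [map_sum, map_smul, hU.corep, slice_sum, slice_mapL]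
  rfl

/-! ### The real structure -/

theorem isJStar_ampl {K : Type v} [NormedAddCommGroup K] [InnerProductSpace ℂ K]
    [CompleteSpace K] (J₁ : H₁ →ₗᵢ⋆[ℂ] H₁) {J₂ : H₂ →ₗᵢ⋆[ℂ] H₂} {U : H₂ ⊗̂ K →L[ℂ] H₂ ⊗̂ K}
    (hU : ∀ ξ, IsJStar J₂ (U ∘L ket K ξ) (U ∘L ket K (J₂ ξ))) (ξ : H₁ ⊗̂ H₂) :
    IsJStar (antilinearMap J₁ J₂) (ampl H₁ U ∘L ket K ξ)
      (ampl H₁ U ∘L ket K (antilinearMap J₁ J₂ ξ)) := by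
  set J := antilinearMap J₁ J₂ with hJ
  have hcont : ∀ k : K, Continuous fun x : H₁ ⊗̂ H₂ => tmul x k := fun k => by
    exact (ketRight (H₁ ⊗̂ H₂) k).continuous.congr fun x => ketRight_apply x k
  -- The operator condition paired with `k` and `k'`. Both sides are additive and continuous in `η`
  -- and `ξ`, so simple tensors suffice.
  have key : ∀ (k k' : K) (η ξ : H₁ ⊗̂ H₂), ⟪tmul (J η) k', ampl H₁ U (tmul (J ξ) k)⟫_ℂ =
      ⟪ampl H₁ U (tmul ξ k'), tmul η k⟫_ℂ := by
    intro k k' η ξ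
    induction η using (denseRange_incl (H := H₁) (K := H₂)).induction_on with
    | hp =>
      exact isClosed_eq (((hcont k').comp J.continuous).inner continuous_const)
        (continuous_const.inner (hcont k))
    | ih η =>
    induction η using TensorProduct.induction_on with
    | zero => simp [tmul]
    | add a b ha hb => simp only [map_add, add_tmul, inner_add_left, inner_add_right, ha, hb]
    | tmul η₁ η₂ =>
    induction ξ using (denseRange_incl (H := H₁) (K := H₂)).induction_on with
    | hp =>
      exact isClosed_eq
        (continuous_const.inner ((ampl H₁ U).continuous.comp ((hcont k).comp J.continuous)))
        (((ampl H₁ U).continuous.comp (hcont k')).inner continuous_const)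
    | ih ξ =>
    induction ξ using TensorProduct.induction_on with
    | zero => simp [tmul]
    | add a b ha hb => simp only [map_add, add_tmul, inner_add_left, inner_add_right, ha, hb]
    | tmul ξ₁ ξ₂ =>
    change ⟪tmul (J (tmul η₁ η₂)) k', ampl H₁ U (tmul (J (tmul ξ₁ ξ₂)) k)⟫_ℂ =
      ⟪ampl H₁ U (tmul (tmul ξ₁ ξ₂) k'), tmul (tmul η₁ η₂) k⟫_ℂ
    -- The hypothesis on `J₂` is by definition a relation between slices of `U`; the conjugation of
    -- `⟪η₁, ξ₁⟫` by `J₁` matches the adjoint.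
    have h : slice U (J₂ η₂) (J₂ ξ₂) = ContinuousLinearMap.adjoint (slice U η₂ ξ₂) := hU ξ₂ η₂
    rw [← inner_conj_symm (ampl H₁ U _), ← inner_slice, ← inner_slice, hJ, antilinearMap_tmul,
      antilinearMap_tmul, slice_ampl_tmul, slice_ampl_tmul, inner_antilinear, h,
      smul_apply, smul_apply, inner_smul_right, inner_smul_right, map_mul,
      ContinuousLinearMap.adjoint_inner_right, inner_conj_symm, inner_conj_symm]
  intro η
  refine ContinuousLinearMap.ext fun k => ext_inner_left ℂ fun k' => ?_
  rw [ContinuousLinearMap.adjoint_inner_right, ContinuousLinearMap.comp_apply,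
    ContinuousLinearMap.comp_apply, ContinuousLinearMap.adjoint_inner_right,
    ContinuousLinearMap.comp_apply, ContinuousLinearMap.adjoint_inner_left]
  exact key k k' η ξ

/-! ### Double commutants and the adjoint action -/

/-- If `a ∈ A₁` and `S ∈ A₂''`, then `a ⊗ S ∈ (A₁ ⊗ A₂)''`. -/
theorem mapL_mem_doubleCommutant (T₁ : SpectralData H₁) (T₂ : SpectralData H₂)
    {a : H₁ →L[ℂ] H₁} (ha : a ∈ T₁.alg) {S : H₂ →L[ℂ] H₂} (hS : S ∈ T₂.doubleCommutant) :
    mapL a S ∈ (T₁.prod T₂).doubleCommutant := by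
  have hgen : ∀ {a b}, a ∈ T₁.alg → b ∈ T₂.alg → mapL a b ∈ (T₁.prod T₂).alg :=
    fun {a b} ha hb => Submodule.subset_span ⟨a, ha, b, hb, rfl⟩
  rw [doubleCommutant, Set.mem_centralizer_iff]
  intro R hR
  rw [Set.mem_centralizer_iff] at hR
  have h1 : mapL a 1 * R = R * mapL a 1 := hR _ (hgen ha T₂.alg.one_mem)
  have h2 : mapL 1 S * R = R * mapL 1 S := by
    -- As `R` commutes with `1 ⊗ A₂`, its slices lie in `A₂'` and hence commute with `S`; slices
    -- determine operators.
    refine slice_injective fun η ξ => ?_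
    rw [slice_mapL_one_mul, slice_mul_mapL_one]
    refine ((Set.mem_centralizer_iff.1 hS) _ (Set.mem_centralizer_iff.2 fun b hb => ?_)).symm
    rw [← slice_mapL_one_mul, ← slice_mul_mapL_one, hR _ (hgen T₁.alg.one_mem hb)]
  have h3 : mapL a S = mapL a 1 * mapL 1 S := by rw [mapL_comp_mapL, mul_one, one_mul]
  rw [h3, ← mul_assoc, ← h1, mul_assoc, ← h2, mul_assoc]

/-- Both the conjugation and the double commutant are linear, so the generators `a₁ ⊗ a₂` decide.
For these the witness is `a₁ ⊗ S`, with `S` the operator that the coaction on the second triple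
provides for `a₂`. -/
theorem exists_slice_eq_ampl [FiniteDimensional ℂ H₂] (T₁ : SpectralData H₁)
    (T₂ : SpectralData H₂) {Q : CompactQuantumGroup.{v}} {U : H₂ ⊗̂ Q.space →L[ℂ] H₂ ⊗̂ Q.space}
    (hU : T₂.IsCoaction Q U) {a : H₁ ⊗̂ H₂ →L[ℂ] H₁ ⊗̂ H₂} (ha : a ∈ (T₁.prod T₂).alg)
    {φ : Q.alg →ₗ[ℂ] ℂ} (hφ : Q.IsState φ) :
    ∃ S ∈ (T₁.prod T₂).doubleCommutant, ∀ η ξ : H₁ ⊗̂ H₂,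
      ∃ h : slice (ampl H₁ U * (mapL a 1 * star (ampl H₁ U))) η ξ ∈ Q.alg,
        ⟪η, S ξ⟫_ℂ = φ ⟨_, h⟩ := by
  let C := Subalgebra.centralizer ℂ (Set.centralizer
    ((T₁.prod T₂).alg : Set (H₁ ⊗̂ H₂ →L[ℂ] H₁ ⊗̂ H₂)))
  have hC : ∀ S, S ∈ C ↔ S ∈ (T₁.prod T₂).doubleCommutant := fun S => Iff.rfl
  change a ∈ Submodule.span ℂ _ at ha
  induction ha using Submodule.span_induction with
  | mem a ha =>
    obtain ⟨a₁, ha₁, a₂, ha₂, rfl⟩ := ha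
    obtain ⟨S, hS, hSφ⟩ := hU.adjoint_mem a₂ ha₂ φ hφ
    refine ⟨mapL a₁ S, mapL_mem_doubleCommutant T₁ T₂ ha₁ hS, fun η ξ => ?_⟩
    let e := stdOrthonormalBasis ℂ H₂
    let E := fun i j => InnerProductSpace.rankOne ℂ (e i) (e j)
    let W := U * (mapL a₂ 1 * star U)
    have hWmem : ∀ i j, slice W (e i) (e j) ∈ Q.alg := fun i j => (hSφ (e i) (e j)).1
    have hWφ : ∀ i j, ⟪e i, S (e j)⟫_ℂ = φ ⟨slice W (e i) (e j), hWmem i j⟩ :=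
      fun i j => (hSφ (e i) (e j)).2
    -- The factor `a₁ ⊗ 1 ⊗ 1` commutes past `1 ⊗ U`, leaving it times the ampliation of `W = U (a₂
    -- ⊗ 1) U*`, which is then expanded in matrix units.
    have hAd : ampl H₁ U * (mapL (mapL a₁ a₂) 1 * star (ampl H₁ U)) =
        ∑ i, ∑ j, mapL (mapL a₁ (E i j)) (slice W (e i) (e j)) := by
      have h1 : mapL (mapL a₁ a₂) 1 =
          mapL (mapL a₁ (1 : H₂ →L[ℂ] H₂)) 1 * ampl H₁ (mapL a₂ (1 : Q.space →L[ℂ] Q.space)) := by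
        rw [ampl_mapL, mapL_comp_mapL, mapL_comp_mapL, mul_one, mul_one, one_mul]
      rw [h1, star_ampl, mul_assoc, ← ampl_mul, ← mul_assoc, ← (commute_ampl a₁ U).eq, mul_assoc,
        ← ampl_mul, ampl_eq_sum e]
      simp only [Finset.mul_sum, mapL_comp_mapL, mul_one, one_mul]
      rfl
    have hslice : slice (ampl H₁ U * (mapL (mapL a₁ a₂) 1 * star (ampl H₁ U))) η ξ =
        ((∑ i, ∑ j, ⟪η, mapL a₁ (E i j) ξ⟫_ℂ • (⟨slice W (e i) (e j), hWmem i j⟩ : Q.alg) :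
          Q.alg) : Q.space →L[ℂ] Q.space) := by
      rw [hAd]
      push_cast
      simp only [slice_sum, slice_mapL]
    have hSsum : mapL a₁ S = ∑ i, ∑ j, ⟪e i, S (e j)⟫_ℂ • mapL a₁ (E i j) := by
      conv_lhs => rw [eq_sum_rankOne e S]
      simp only [mapL_sum, mapL_smul, E]
    refine ⟨hslice ▸ Subtype.property _, ?_⟩
    -- The argument of `φ` carries its membership proof, so the sum is substituted as an equality in
    -- `Q.alg`; then `hWφ` matches the entries of `S` with `φ` of those of `W`.
    have hsub : (⟨_, hslice ▸ Subtype.property _⟩ : Q.alg) = _ := Subtype.ext hslice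
    rw [hsub, hSsum]
    simp only [map_sum, map_smul, sum_apply, smul_apply, inner_sum, inner_smul_right, hWφ,
      smul_eq_mul]
    exact Finset.sum_congr rfl fun i _ => Finset.sum_congr rfl fun j _ => mul_comm _ _
  | zero =>
    refine ⟨0, (hC 0).1 C.zero_mem, fun η ξ => ?_⟩
    have h0 : slice (ampl H₁ U * (mapL (0 : H₁ ⊗̂ H₂ →L[ℂ] H₁ ⊗̂ H₂) 1 * star (ampl H₁ U))) η ξ =
        ((0 : Q.alg) : Q.space →L[ℂ] Q.space) := by
      have := smul_mapL (0 : ℂ) (0 : H₁ ⊗̂ H₂ →L[ℂ] H₁ ⊗̂ H₂) (1 : Q.space →L[ℂ] Q.space)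
      rw [zero_smul, zero_smul] at this
      rw [this]
      simp [slice]
    refine ⟨h0 ▸ Subtype.property _, ?_⟩
    have hsub : (⟨_, h0 ▸ Subtype.property _⟩ : Q.alg) = _ := Subtype.ext h0
    rw [hsub]
    simp
  | add a b _ _ ha hb =>
    obtain ⟨S, hS, hSφ⟩ := ha
    obtain ⟨S', hS', hSφ'⟩ := hb
    refine ⟨S + S', (hC _).1 (C.add_mem hS hS'), fun η ξ => ?_⟩
    obtain ⟨h, e⟩ := hSφ η ξ
    obtain ⟨h', e'⟩ := hSφ' η ξ
    have hadd : slice (ampl H₁ U * (mapL (a + b) 1 * star (ampl H₁ U))) η ξ =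
        ((⟨_, h⟩ + ⟨_, h'⟩ : Q.alg) : Q.space →L[ℂ] Q.space) := by
      rw [add_mapL, add_mul, mul_add]
      refine ContinuousLinearMap.ext fun x => ?_
      simp [slice]
    refine ⟨hadd ▸ Subtype.property _, ?_⟩
    have hsub : (⟨_, hadd ▸ Subtype.property _⟩ : Q.alg) = _ := Subtype.ext hadd
    rw [hsub, map_add, ← e, ← e', add_apply, inner_add_right]
  | smul c a _ ha =>
    obtain ⟨S, hS, hSφ⟩ := ha
    refine ⟨c • S, (hC _).1 (C.smul_mem hS c), fun η ξ => ?_⟩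
    obtain ⟨h, e⟩ := hSφ η ξ
    have hsmul : slice (ampl H₁ U * (mapL (c • a) 1 * star (ampl H₁ U))) η ξ =
        ((c • ⟨_, h⟩ : Q.alg) : Q.space →L[ℂ] Q.space) := by
      rw [smul_mapL, smul_mul_assoc, mul_smul_comm]
      refine ContinuousLinearMap.ext fun x => ?_
      simp [slice]
    refine ⟨hsmul ▸ Subtype.property _, ?_⟩
    have hsub : (⟨_, hsmul ▸ Subtype.property _⟩ : Q.alg) = _ := Subtype.ext hsmul
    rw [hsub, map_smul, ← e, smul_apply, inner_smul_right, smul_eq_mul]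

/-! ### The coaction on the product triple -/

theorem IsCoaction.ampl_prod [FiniteDimensional ℂ H₂] (T₁ : SpectralData H₁)
    {T₂ : SpectralData H₂} (hD₂ : Dense (T₂.D.domain : Set H₂)) {Q : CompactQuantumGroup.{v}}
    {U : H₂ ⊗̂ Q.space →L[ℂ] H₂ ⊗̂ Q.space} (hU : T₂.IsCoaction Q U) :
    (T₁.prod T₂).IsCoaction Q (ampl H₁ U) where
  isCorep := isUnitaryCorep_ampl hU.isCorep
  comm_D := commutesWith_ampl hD₂ hU.isCorep.isUnitary hU.comm_γ hU.comm_D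
  comm_γ := by
    -- Splitting the grading as `(γ₁ ⊗ 1)(1 ⊗ γ₂)`: the first factor acts on a leg that `1 ⊗ U` does
    -- not touch, the second commutes by ampliating `hU.comm_γ`.
    have h1 : mapL (mapL T₁.γ T₂.γ) 1 = mapL (mapL T₁.γ (1 : H₂ →L[ℂ] H₂)) 1 *
        ampl H₁ (mapL T₂.γ (1 : Q.space →L[ℂ] Q.space)) := by
      rw [ampl_mapL, mapL_comp_mapL, mapL_comp_mapL, mul_one, mul_one, one_mul]
    have h2 : Commute (ampl H₁ U) (ampl H₁ (mapL T₂.γ (1 : Q.space →L[ℂ] Q.space))) := by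
      have h : U * mapL T₂.γ 1 = mapL T₂.γ 1 * U := hU.comm_γ
      rw [Commute, SemiconjBy, ← ampl_mul, ← ampl_mul, h]
    change Commute (ampl H₁ U) (mapL (mapL T₁.γ T₂.γ) 1)
    rw [h1]
    exact (commute_ampl T₁.γ U).symm.mul_right h2
  comm_J := isJStar_ampl T₁.J hU.comm_J
  adjoint_mem _ ha _ hφ := exists_slice_eq_ampl T₁ T₂ hU ha hφ

end SpectralData

theorem mainTheorem9
    {H₁ : Type u₁} [NormedAddCommGroup H₁] [InnerProductSpace ℂ H₁] [CompleteSpace H₁]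
    {H₂ : Type u₂} [NormedAddCommGroup H₂] [InnerProductSpace ℂ H₂] [CompleteSpace H₂]
    [FiniteDimensional ℂ H₂]
    (T₁ : SpectralData H₁) (hT₁ : T₁.IsReal)
    (T₂ : SpectralData H₂) (hT₂ : T₂.IsReal) (hT₂_even : T₂.IsEven) :
    (∀ (Q : CompactQuantumGroup.{v}) (U : H₂ ⊗̂ Q.space →L[ℂ] H₂ ⊗̂ Q.space),
      T₂.IsQISO Q U → (T₁.prod T₂).IsCoaction Q (HilbertTensor.ampl H₁ U)) ∧
    (∀ (Q : CompactQuantumGroup.{v}) (U : H₂ ⊗̂ Q.space →L[ℂ] H₂ ⊗̂ Q.space),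
      T₂.IsCoaction Q U → (T₁.prod T₂).IsCoaction Q (HilbertTensor.ampl H₁ U)) := by
  have key : ∀ (Q : CompactQuantumGroup.{v}) (U : H₂ ⊗̂ Q.space →L[ℂ] H₂ ⊗̂ Q.space),
      T₂.IsCoaction Q U → (T₁.prod T₂).IsCoaction Q (HilbertTensor.ampl H₁ U) :=
    fun _ _ hU => hU.ampl_prod T₁ hT₂.isSpectralTriple.selfAdjoint.dense_domain
  exact ⟨fun Q U hU => key Q U hU.isCoaction, key⟩
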